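/- Let $F,G,H$ be holomorphic near the origin of $\mathbb{C}^3$ and vanish at the origin, and let $\Lambda$ be the linear part at the origin of the system $$\dot x=F(x,y,z),\qquad \dot y=G(x,y,z),\qquad \dot z=H(x,y,z)\qquad(*)$$ (with real time). Let $\omega_1,\omega_2$ be non-zero real numbers with $\omega_1\neq\omega_2$ and $|\omega_1|\le|\omega_2|$. Assume that $i\omega_1$ is an eigenvalue of $\Lambda$ with eigenspace the $x$-axis, and that $i\omega_2$ is an eigenvalue of $\Lambda$ with eigenspace the $(y,z)$-plane (so $\Lambda$ is diagonalizable). Let $E$ be the $x$-axis or the $(y,z)$-plane. An $E$-invariant holomorphic center manifold at the origin is a germ at the origin of a complex submanifold of $\mathbb{C}^3$ through the origin that is invariant under $(*)$ (i.e. $(F,G,H)$ is tangent to it) and whose tangent space at the origin is $E$; equivalently, it is the germ of the graph of a holomorphic map $h$ from a neighbourhood of $0$ in $E$ to the complementary coordinate subspace, with $h(0)=0$, $dh(0)=0$, to which $(F,G,H)$ is tangent. It contains an isochronous center family of period $T$ if all of its points other than the origin and sufficiently close to it lie on periodic solutions of $(*)$ of least period $T$ that stay in the manifold, and stay arbitrarily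 close to the origin if they start sufficiently close to it. If $m=\omega_2/\omega_1\in\mathbb{N}$ (so $m\ge 2$), define numbers $\bar p,\bar r$ as follows. The substitution $y=xu$, $z=xv$ turns the equations $F\,y'(x)=G$, $F\,z'(x)=H$ into the system $$xu'=\frac{G(x,xu,xv)}{F(x,xu,xv)}-u=(m-1)u+p_0x+O(2),\qquad xv'=\frac{H(x,xu,xv)}{F(x,xu,xv)}-v=(m-1)v+r_0x+O(2)$$ (quotients extended holomorphically to $x=0$), where $O(2)$ denotes terms of order at least two in $(x,u,v)$. As long as the system has the form $xu'=qu+px+O(2)$, $xv'=qv+rx+O(2)$ with $q>1$, substitute $u=x\bigl(\tilde u+\tfrac{p}{1-q}\bigr)$, $v=x\bigl(\tilde v+\tfrac{r}{1-q}\bigr)$; this gives a system of the same form for $\tilde u,\tilde v$ with $q-1$ in place of $q$. After $m-2$ such steps one has $$x\bar u'=\bar u+\bar p\,x+O(2),\qquad x\bar v'=\bar v+\bar r\,x+O(2),$$ which defines $\bar p$ and $\bar r$. Then: 1) $(*)$ has a $(y,z)$-invariant holomorphic center manifold at the origin which contains an isochronous center family of period $2\pi/|\omega_2|$. 2) If $\omega_2/\omega_1\notin\mathbb{N}$,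 then $(*)$ has an $x$-invariant holomorphic center manifold at the origin which contains an isochronous center family of period $2\pi/|\omega_1|$. 3) Suppose $\omega_2/\omega_1\in\mathbb{N}$. 3.1) If $\bar p=0$ and $\bar r=0$, then $(*)$ has infinitely many $x$-invariant holomorphic center manifolds at the origin, and each of them contains an isochronous center family of period $2\pi/|\omega_1|$. 3.2) If $\bar p\neq 0$ or $\bar r\neq 0$, then $(*)$ has no $x$-invariant holomorphic center manifold at the origin. -/

import Mathlib

open Filter Topology

noncomputable section

/-- The phase space, with coordinates `(x, y, z)`. -/
abbrev Phase : Type := ℂ × ℂ × ℂ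

/-- The vector field with components `F`, `G`, `H`. -/
def vectorField (F G H : Phase → ℂ) : Phase → Phase := fun p => (F p, G p, H p)

/-- The linear part at the origin of the vector field with components `F`, `G`, `H`. -/
def linearPart (F G H : Phase → ℂ) : Phase →ₗ[ℂ] Phase :=
  (fderiv ℂ (vectorField F G H) 0 : Phase →L[ℂ] Phase)

/-- The `x`-axis. -/
def xAxis : Submodule ℂ Phase := LinearMap.range (LinearMap.inl ℂ ℂ (ℂ × ℂ))

/-- The `(y, z)`-plane. -/
def yzPlane : Submodule ℂ Phase := LinearMap.range (LinearMap.inr ℂ ℂ (ℂ × ℂ))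

/-- The phase space as `x`-axis (base) times `(y, z)`-plane (fibre). -/
def xSplitting : (ℂ × (ℂ × ℂ)) ≃L[ℂ] Phase := ContinuousLinearEquiv.refl ℂ Phase

/-- The phase space as `(y, z)`-plane (base) times `x`-axis (fibre). -/
def yzSplitting : ((ℂ × ℂ) × ℂ) ≃L[ℂ] Phase :=
  ContinuousLinearEquiv.prodComm ℂ (ℂ × ℂ) ℂ

section CenterManifolds

variable {E E' : Type*} [NormedAddCommGroup E] [NormedSpace ℂ E]
  [NormedAddCommGroup E'] [NormedSpace ℂ E']

/-- The parametrization `e ↦ (e, h e)` of the graph of `h`, in the phase space split as `E × E'`. -/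
def graphMap (L : (E × E') ≃L[ℂ] Phase) (h : E → E') : E → Phase := fun e => L (e, h e)

/-- Near the origin, the graph of `h` over the base `E` of the splitting `L` is a holomorphic
invariant manifold of `X` through the origin which is tangent there to `E`. Every complex
submanifold through the origin tangent to `E` is locally such a graph. Invariance says that `X` is
tangent to the graph. Only the germ of `h` at `0` matters. -/
structure IsCenterManifold (X : Phase → Phase) (L : (E × E') ≃L[ℂ] Phase) (h : E → E') :
    Prop where
  analytic : AnalyticAt ℂ h 0
  map_zero : h 0 = 0
  tangent : fderiv ℂ h 0 = 0
  invariant : ∀ᶠ e in 𝓝 (0 : E), X (graphMap L h e) ∈ Set.range (fderiv ℂ (graphMap L h) e)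

/-- `γ` is a solution, for all real times, of the differential equation given by `X`, and it is
periodic with least positive period `T`. -/
structure IsPeriodicSolution (X : Phase → Phase) (γ : ℝ → Phase) (T : ℝ) : Prop where
  solution : ∀ t, HasDerivAt γ (X (γ t)) t
  pos : 0 < T
  periodic : Function.Periodic γ T
  minimal : ∀ T', 0 < T' → Function.Periodic γ T' → T ≤ T'

/-- The graph of `h` contains an isochronous center family of period `T`: all points of the graph
other than the origin and sufficiently close to it lie on periodic solutions of least period `T`
that stay in the graph, arbitrarily close to the origin if they start sufficiently close to it. -/
def HasIsochronousFamily (X : Phase → Phase) (L : (E × E') ≃L[ℂ] Phase) (h : E → E')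
    (T : ℝ) : Prop :=
  ∀ W ∈ 𝓝 (0 : E), ∃ U ∈ 𝓝 (0 : E), ∀ e ∈ U, e ≠ 0 →
    ∃ γ : ℝ → Phase, γ 0 = graphMap L h e ∧ IsPeriodicSolution X γ T ∧
      ∀ t, γ t ∈ graphMap L h '' W

/-- The germs at the origin of the holomorphic invariant manifolds of `X` tangent to `E`. -/
def centerManifoldGerms (X : Phase → Phase) (L : (E × E') ≃L[ℂ] Phase) :
    Set (Germ (𝓝 (0 : E)) E') :=
  {g | ∃ h : E → E', IsCenterManifold X L h ∧ (h : Germ (𝓝 (0 : E)) E') = g}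

end CenterManifolds

section BriotBouquet

/-- `f (x, x u, x v) / x`, holomorphically extended to `x = 0` (for `f` holomorphic near the origin
with `f 0 = 0`). -/
def blowUp (f : Phase → ℂ) (p : Phase) : ℂ :=
  dslope (fun t : ℂ => f (t, t * p.2.1, t * p.2.2)) 0 p.1

/-- The right-hand side `B` of the Briot-Bouquet system `x (u', v') = B (x, u, v)` that
`F y' = G`, `F z' = H` becomes under `y = x u`, `z = x v`. -/
def initialSystem (F G H : Phase → ℂ) : Phase → ℂ × ℂ := fun p =>
  (blowUp G p / blowUp F p - p.2.1, blowUp H p / blowUp F p - p.2.2)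

/-- The coefficients of `x` in the linear part of the right-hand side `B` of a Briot-Bouquet
system. -/
def xCoeff (B : Phase → ℂ × ℂ) : ℂ × ℂ := deriv (fun t : ℂ => B (t, 0, 0)) 0

/-- One change of variables `u = x (ũ + p / (1 - q))`, `v = x (ṽ + r / (1 - s))` in the system
`x u' = p x + q u + ⋯`, `x v' = r x + s v + ⋯`: the right-hand side of the system for `ũ`, `ṽ`. -/
def bbStep (q s : ℂ) (B : Phase → ℂ × ℂ) : Phase → ℂ × ℂ := fun w =>
  let c := (xCoeff B).1 / (1 - q)
  let d := (xCoeff B).2 / (1 - s)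
  dslope (fun t : ℂ => B (t, t * (w.2.1 + c), t * (w.2.2 + d))) 0 w.1 - (w.2.1 + c, w.2.2 + d)

/-- `k` successive changes of variables; each one lowers the eigenvalues `q`, `s` by one. -/
def bbIterate (q s : ℂ) (B : Phase → ℂ × ℂ) : ℕ → Phase → ℂ × ℂ
  | 0 => B
  | k + 1 => bbStep (q - k) (s - k) (bbIterate q s B k)

/-- The pair `(p̄, r̄)` for eigenvalue ratio `m ≥ 2`: the initial system has eigenvalues `m - 1`,
`m - 1`, and after `m - 2` changes of variables it has become
`x ū' = ū + p̄ x + O(2)`, `x v̄' = v̄ + r̄ x + O(2)`. -/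
def obstruction (F G H : Phase → ℂ) (m : ℕ) : ℂ × ℂ :=
  xCoeff (bbIterate ((m : ℂ) - 1) ((m : ℂ) - 1) (initialSystem F G H) (m - 2))

end BriotBouquet

end

/-! Two mechanisms carry the theorem.

Linearizing parametrizations (`exists_linearizing_parametrization`). Suppose the linear part is `l`
on the image of `ι` and `l β` on a complement, with `β ≤ 1`. One seeks `K w = ι w + m(w)(w, w)`,
with `m` valued in bilinear maps, such that `DK(w)(l w) = X(K w)`. Two applications of Hadamard's
lemma write `X v = l (B v + Q(v)(v, v))`, and the equation for `m` becomes `Dm(w) w + 2 m - B m =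
Q(K w)` pulled back by a `w`-dependent linear map. After `m(0)` is split off, this is a singular
equation with the positive coefficients `1` and `2 - β`. Integration along rays against `t ^ a`
turns it into an integral equation for paths on `[0, 1]`, which the analytic implicit function
theorem solves (`exists_analytic_integral_solution`). With `l = i ω₂` and `β = ω₁ / ω₂` this gives
the manifold over the `(y, z)`-plane. Applied to the reduced field on any center manifold of either
kind, it conjugates that field to `w ↦ i ω w`, whose solutions `exp(i ω t) w` all have the same
least period; hence `IsCenterManifold.hasIsochronousFamily`.

Briot-Bouquet reduction. Over the `x`-axis, writing the graph as `x φ(x)` turns invariance into `x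
φ' = B(x, φ)` with eigenvalue `q = ω₂ / ω₁ - 1`. The substitution `u = x (ũ + c)` lowers `q` by one,
and a solution has slope `c` only if `xCoeff B + (q - 1) c = 0`. For `q ≠ 1` this determines `c`.
Without resonance the reduction therefore continues until `q ≤ -1`, where the ray integral applies.
With resonance it reaches `q = 1`, where `c` drops out of the condition: if the coefficient of `x`
is non-zero there is no solution, and if it is zero every slope `c` is realized. -/

noncomputable section

/-! ### Hadamard's lemma and superposition operators. -/

/-- Hadamard's lemma: a function that is analytic and vanishes at the origin is
`z ↦ L z z` for an operator-valued analytic function `L`. -/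
theorem AnalyticAt.exists_eq_clm_apply {𝕜 Z W : Type*} [NontriviallyNormedField 𝕜]
    [NormedAddCommGroup Z] [NormedSpace 𝕜 Z] [NormedAddCommGroup W] [NormedSpace 𝕜 W]
    [CompleteSpace W] {f : Z → W} (hf : AnalyticAt 𝕜 f 0) (h0 : f 0 = 0) :
    ∃ L : Z → Z →L[𝕜] W, AnalyticAt 𝕜 L 0 ∧ L 0 = fderiv 𝕜 f 0 ∧ ∀ᶠ z in 𝓝 0, f z = L z z := by
  obtain ⟨p, r, hp⟩ := hf
  have hrad : 0 < p.shift.radius := by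
    rw [p.radius_shift]
    exact hp.r_pos.trans_le hp.r_le
  have hL := p.shift.hasFPowerSeriesOnBall hrad
  have hev : ∀ᶠ z in 𝓝 0, f z = p.shift.sum z z := by
    have h1 : Metric.eball (0 : Z) r ∈ 𝓝 0 := Metric.eball_mem_nhds _ hp.r_pos
    have h2 : Metric.eball (0 : Z) p.shift.radius ∈ 𝓝 0 := Metric.eball_mem_nhds _ hrad
    filter_upwards [h1, h2] with z hz1 hz2
    have e1 := hp.hasSum hz1
    have e2 := (ContinuousLinearMap.apply 𝕜 W z).hasSum (hL.hasSum hz2)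
    simp only [zero_add] at e1 e2
    rw [← hasSum_nat_add_iff' 1] at e1
    have hp0 : p 0 (fun _ => z) = 0 := by rw [hp.coeff_zero, h0]
    simp only [Finset.range_one, Finset.sum_singleton, hp0, sub_zero] at e1
    refine e1.unique ?_
    convert! e2 using 2 with n
    simp only [ContinuousLinearMap.apply_apply, FormalMultilinearSeries.shift,
      ContinuousMultilinearMap.curryRight_apply]
    congr 1
    ext i
    induction i using Fin.lastCases <;> simp
  refine ⟨p.shift.sum, hL.analyticAt, ?_, hev⟩
  -- In the product rule at `0` the term containing the derivative of the operator is evaluated at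
  -- `z = 0` and vanishes.
  have hd : HasFDerivAt (fun z => p.shift.sum z z) (p.shift.sum 0) 0 := by
    have := hL.analyticAt.differentiableAt.hasFDerivAt.clm_apply (hasFDerivAt_id (0 : Z))
    convert! this using 1
    ext; simp
  exact ((hd.congr_of_eventuallyEq hev).fderiv).symm

/-- The superposition operator of an analytic function on spaces of continuous functions
is analytic. -/
theorem AnalyticAt.exists_superposition {𝕜 Z W : Type*} (I : Type*) [NontriviallyNormedField 𝕜]
    [TopologicalSpace I] [CompactSpace I]
    [NormedAddCommGroup Z] [NormedSpace 𝕜 Z] [NormedAddCommGroup W] [NormedSpace 𝕜 W]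
    [CompleteSpace W] {f : Z → W} (hf : AnalyticAt 𝕜 f 0) :
    ∃ Φ : C(I, Z) → C(I, W), AnalyticAt 𝕜 Φ 0 ∧ ∀ᶠ φ in 𝓝 0, ∀ t, Φ φ t = f (φ t) := by
  obtain ⟨p, r, hp⟩ := hf
  -- The coefficients of `f` act pointwise. Their norms do not increase, so the new series converges
  -- on a ball of at least the old radius.
  let P : FormalMultilinearSeries 𝕜 C(I, Z) C(I, W) := fun n =>
    MultilinearMap.mkContinuous
      { toFun := fun φ => ⟨fun t => p n (fun i => φ i t), by fun_prop⟩
        map_update_add' := by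
          intro _ m i x y
          ext t
          have key : ∀ z : C(I, Z), (fun j => (Function.update m i z) j t)
              = Function.update (fun j => m j t) i (z t) := by
            intro z; ext j; by_cases h : j = i
            · subst h; simp
            · simp [h]
          simp [key]
        map_update_smul' := by
          intro _ m i c x
          ext t
          have key : ∀ z : C(I, Z), (fun j => (Function.update m i z) j t)
              = Function.update (fun j => m j t) i (z t) := by
            intro z; ext j; by_cases h : j = i
            · subst h; simp
            · simp [h]
          simp [key] } ‖p n‖ (by
        intro φ
        refine (ContinuousMap.norm_le _ (by positivity)).2 fun t => ?_
        refine ((p n).le_opNorm _).trans ?_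
        gcongr
        exact (φ _).norm_coe_le_norm t)
  have hPn : ∀ n, ‖P n‖ ≤ ‖p n‖ := fun n => MultilinearMap.mkContinuous_norm_le _ (norm_nonneg _) _
  have hrad : r ≤ P.radius := hp.r_le.trans (FormalMultilinearSeries.radius_le_of_le hPn)
  have hP := P.hasFPowerSeriesOnBall (hp.r_pos.trans_le hrad)
  refine ⟨P.sum, hP.analyticAt, ?_⟩
  have h1 : Metric.eball (0 : C(I, Z)) r ∈ 𝓝 0 := Metric.eball_mem_nhds _ hp.r_pos
  filter_upwards [h1] with φ hφ t
  have e2 := (ContinuousMap.evalCLM 𝕜 t : C(I, W) →L[𝕜] W).hasSum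
    (hP.hasSum (Metric.eball_subset_eball hrad hφ))
  have hφt : φ t ∈ Metric.eball (0 : Z) r := by
    rw [mem_eball_zero_iff] at hφ ⊢
    refine lt_of_le_of_lt ?_ hφ
    rw [← ofReal_norm, ← ofReal_norm]
    exact ENNReal.ofReal_le_ofReal (φ.norm_coe_le_norm t)
  have e1 := hp.hasSum hφt
  simp only [zero_add] at e1 e2
  exact e2.unique e1

/-! ### Singular equations solved by integration along rays. -/

/-- The function `s ↦ ∫₀¹ tᵃ G(ts) dt` solves `s v' + (a + 1) v = G`; here at `s = 1`. -/
theorem hasDerivAt_integral_rpow_smul {W : Type*} [NormedAddCommGroup W] [NormedSpace ℝ W]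
    [CompleteSpace W] {a r : ℝ} (ha : 0 ≤ a) (hr : 1 < r) {G v : ℝ → W}
    (hG : ContinuousOn G (Set.Ioo (-r) r))
    (hv : ∀ᶠ s in 𝓝 (1 : ℝ), v s = ∫ t in (0 : ℝ)..1, t ^ a • G (t * s)) :
    HasDerivAt v (G 1 - (a + 1) • v 1) 1 := by
  set f : ℝ → W := fun t => t ^ a • G t with hf
  have hfc : ContinuousOn f (Set.Ioo (-r) r) :=
    (Real.continuous_rpow_const ha).continuousOn.smul hG
  have hmem : (1 : ℝ) ∈ Set.Ioo (-r) r := ⟨by linarith, hr⟩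
  have hint : IntervalIntegrable f MeasureTheory.volume 0 1 := by
    refine (hfc.mono ?_).intervalIntegrable
    rw [Set.uIcc_of_le zero_le_one]
    intro t ht
    exact ⟨by linarith [ht.1], by linarith [ht.2]⟩
  have hderiv := intervalIntegral.integral_hasDerivAt_right hint
    (hfc.stronglyMeasurableAtFilter isOpen_Ioo _ hmem) (hfc.continuousAt (isOpen_Ioo.mem_nhds hmem))
  -- The substitution `t s → t` exhibits `s ^ (a + 1) v(s)` as a primitive of `s ^ a G(s)`.
  have hev : v =ᶠ[𝓝 1] fun s => s ^ (-(a + 1)) • ∫ t in (0 : ℝ)..s, f t := by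
    filter_upwards [hv, lt_mem_nhds (zero_lt_one : (0 : ℝ) < 1)] with s hs hs0
    have h1 : ∫ t in (0 : ℝ)..1, t ^ a • G (t * s) = ∫ t in (0 : ℝ)..1, s ^ (-a) • f (t * s) := by
      refine intervalIntegral.integral_congr fun t ht => ?_
      rw [Set.uIcc_of_le zero_le_one] at ht
      simp only [hf]
      rw [smul_smul, Real.mul_rpow ht.1 hs0.le, mul_comm (t ^ a), ← mul_assoc,
        ← Real.rpow_add hs0, neg_add_cancel, Real.rpow_zero, one_mul]
    rw [hs, h1, intervalIntegral.integral_smul, intervalIntegral.integral_comp_mul_right f hs0.ne',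
      smul_smul, zero_mul, one_mul, neg_add, Real.rpow_add hs0, Real.rpow_neg_one]
  have hpow : HasDerivAt (fun s : ℝ => s ^ (-(a + 1))) (-(a + 1)) 1 := by
    simpa using Real.hasDerivAt_rpow_const (x := 1) (p := -(a + 1)) (Or.inl one_ne_zero)
  have hprod := (hpow.smul hderiv).congr_of_eventuallyEq hev
  have hv1 := hev.self_of_nhds
  simp only [Real.one_rpow, one_smul] at hv1
  convert! hprod using 1
  simp only [Real.one_rpow, one_smul, hf, hv1, neg_smul]
  abel

/-- The operator `f ↦ (s ↦ ∫₀¹ M(t) f(ts) dt)`. -/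
def dilationOp {W : Type*} [NormedAddCommGroup W] [NormedSpace ℂ W]
    (M : C(unitInterval, W →L[ℂ] W)) :
    C(unitInterval, W) →L[ℂ] C(unitInterval, W) :=
  have hint : ∀ (f : C(unitInterval, W)) (s : unitInterval),
      MeasureTheory.Integrable (fun t => M t (f (t * s))) := fun f s =>
    (show Continuous fun t => M t (f (t * s)) by fun_prop).integrable_of_hasCompactSupport
      (HasCompactSupport.of_compactSpace _)
  LinearMap.mkContinuous
    { toFun := fun f => ⟨fun s => ∫ t : unitInterval, M t (f (t * s)), by
        refine continuousOn_univ.1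
          (continuousOn_integral_of_compact_support (k := Set.univ) isCompact_univ ?_ ?_)
        · exact Continuous.continuousOn (by fun_prop)
        · simp⟩
      map_add' := fun f g => by
        ext s
        simp only [ContinuousMap.coe_mk, ContinuousMap.add_apply, map_add]
        exact MeasureTheory.integral_add (hint f s) (hint g s)
      map_smul' := fun c f => by
        ext s
        simp only [ContinuousMap.coe_mk, ContinuousMap.smul_apply, map_smul, RingHom.id_apply]
        exact MeasureTheory.integral_smul c _ } ‖M‖ fun f => by
    refine (ContinuousMap.norm_le _ (by positivity)).2 fun s => ?_
    refine (MeasureTheory.norm_integral_le_of_norm_le_const (C := ‖M‖ * ‖f‖)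
      (Eventually.of_forall fun t => ?_)).trans (by simp)
    refine ((M t).le_opNorm _).trans ?_
    gcongr
    · exact M.norm_coe_le_norm t
    · exact f.norm_coe_le_norm _

theorem dilationOp_apply {W : Type*} [NormedAddCommGroup W] [NormedSpace ℂ W]
    (M : C(unitInterval, W →L[ℂ] W)) (f : C(unitInterval, W)) (s : unitInterval) :
    dilationOp M f s = ∫ t : unitInterval, M t (f (t * s)) := rfl

/-- The path `t ↦ (t x, U t)` as a continuous linear function of `(x, U)`. -/
def rayPath (E W : Type*) [NormedAddCommGroup E] [NormedSpace ℂ E]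
    [NormedAddCommGroup W] [NormedSpace ℂ W] :
    (E × C(unitInterval, W)) →L[ℂ] C(unitInterval, E × W) :=
  LinearMap.mkContinuous
    { toFun := fun p => ⟨fun t => (((t : ℝ) : ℂ) • p.1, p.2 t), by fun_prop⟩
      map_add' := fun p q => by ext t <;> simp
      map_smul' := fun c p => by ext t; exacts [smul_comm _ _ _, rfl] } 1 fun p => by
    refine (ContinuousMap.norm_le _ (by positivity)).2 fun t => ?_
    rw [one_mul]
    refine max_le_max ?_ (p.2.norm_coe_le_norm t)
    change ‖((t : ℝ) : ℂ) • p.1‖ ≤ ‖p.1‖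
    simp only [norm_smul, Complex.norm_real, Real.norm_eq_abs, abs_of_nonneg t.2.1]
    exact mul_le_of_le_one_left (norm_nonneg _) t.2.2

@[simp] theorem rayPath_apply {E W : Type*} [NormedAddCommGroup E] [NormedSpace ℂ E]
    [NormedAddCommGroup W] [NormedSpace ℂ W] (p : E × C(unitInterval, W)) (t : unitInterval) :
    rayPath E W p t = (((t : ℝ) : ℂ) • p.1, p.2 t) := rfl

/-- An integral equation along rays with analytic right-hand side has an analytic solution. -/
theorem exists_analytic_integral_solution {E W : Type*} [NormedAddCommGroup E] [NormedSpace ℂ E]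
    [CompleteSpace E] [NormedAddCommGroup W] [NormedSpace ℂ W] [CompleteSpace W]
    (M : C(unitInterval, W →L[ℂ] W)) {N : E × W → W} (hN : AnalyticAt ℂ N 0) (hN0 : N 0 = 0)
    (hD : ∀ v, fderiv ℂ N 0 (0, v) = 0) :
    ∃ u : E → W, AnalyticAt ℂ u 0 ∧ u 0 = 0 ∧
      ∀ᶠ x in 𝓝 0, u x = ∫ t : unitInterval,
        M t (N (((t : ℝ) : ℂ) • x, u (((t : ℝ) : ℂ) • x))) := by
  obtain ⟨Φ, hΦ, hΦN⟩ := hN.exists_superposition unitInterval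
  set J := dilationOp M
  set σ := rayPath E W
  have hΦ0 : Φ 0 = 0 := by
    ext t
    rw [hΦN.self_of_nhds t]
    exact hN0
  set f : E × C(unitInterval, W) → C(unitInterval, W) := fun p => p.2 - J (Φ (σ p)) with hf
  have hσ0 : σ 0 = 0 := map_zero _
  have hΦ' : AnalyticAt ℂ Φ (σ 0) := by rwa [hσ0]
  have hcomp : AnalyticAt ℂ (fun p => J (Φ (σ p))) 0 :=
    (J.analyticAt _).comp (hΦ'.comp (σ.analyticAt 0))
  have hfa : AnalyticAt ℂ f 0 := analyticAt_snd.sub hcomp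
  have hf0 : f 0 = 0 := by simp [hf, hσ0, hΦ0]
  have hdΦ : ∀ ψ t, fderiv ℂ Φ 0 ψ t = fderiv ℂ N 0 (ψ t) := by
    intro ψ t
    have h1 : HasFDerivAt (fun φ : C(unitInterval, E × W) => Φ φ t)
        ((ContinuousMap.evalCLM ℂ t).comp (fderiv ℂ Φ 0)) 0 :=
      (ContinuousMap.evalCLM ℂ t : C(unitInterval, W) →L[ℂ] W).hasFDerivAt.comp 0
        hΦ.differentiableAt.hasFDerivAt
    have h2 : HasFDerivAt (fun φ : C(unitInterval, E × W) => N (φ t))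
        ((fderiv ℂ N 0).comp (ContinuousMap.evalCLM ℂ t)) 0 := by
      refine HasFDerivAt.comp (g := N) 0 ?_
        (ContinuousMap.evalCLM ℂ t : C(unitInterval, E × W) →L[ℂ] E × W).hasFDerivAt
      exact hN.differentiableAt.hasFDerivAt
    have h3 := h1.congr_of_eventuallyEq
      (hΦN.mono fun φ hφ => (hφ t).symm : (fun φ => N (φ t)) =ᶠ[𝓝 0] fun φ => Φ φ t)
    exact congrArg (fun A => A ψ) (h3.unique h2)
  have hdf : fderiv ℂ f 0 ∘L .inr ℂ E C(unitInterval, W) = .id ℂ _ := by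
    have h1 : HasFDerivAt f (ContinuousLinearMap.snd ℂ E C(unitInterval, W)
        - J.comp ((fderiv ℂ Φ 0).comp σ)) 0 := by
      refine hasFDerivAt_snd.sub (J.hasFDerivAt.comp 0 (HasFDerivAt.comp (g := Φ) 0 ?_ σ.hasFDerivAt))
      rw [hσ0]
      exact hΦ.differentiableAt.hasFDerivAt
    rw [h1.fderiv]
    ext1 V
    have : fderiv ℂ Φ 0 (σ (0, V)) = 0 := by
      ext t
      rw [hdΦ]
      simpa [σ] using hD (V t)
    simp [this]
  have hinv : (fderiv ℂ f 0 ∘L .inr ℂ E C(unitInterval, W)).IsInvertible := by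
    rw [hdf]
    exact ContinuousLinearMap.isInvertible_equiv (f := .refl ℂ _)
  have cdf : ContDiffAt ℂ ⊤ f 0 := hfa.contDiffAt
  set U := cdf.implicitFunction (by simp) hinv with hU
  have hUan : AnalyticAt ℂ U 0 := (cdf.contDiffAt_implicitFunction (by simp) hinv).analyticAt
  have hU0 : U 0 = 0 := cdf.implicitFunction_apply_self (by simp) hinv
  have ha : ∀ᶠ x in 𝓝 (0 : E), f (x, U x) = 0 := by
    rw [← hf0]; exact cdf.eventually_apply_implicitFunction (by simp) hinv
  have hb : ∀ᶠ v in 𝓝 (0 : E × C(unitInterval, W)), f v = 0 → U v.1 = v.2 := by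
    filter_upwards [cdf.eventually_apply_eq_iff_implicitFunction (by simp) hinv] with v hv h
    exact hv.1 (h.trans hf0.symm)
  have hc : ∀ᶠ v in 𝓝 (0 : E × C(unitInterval, W)), ∀ t, Φ (σ v) t = N (σ v t) := by
    have : Tendsto σ (𝓝 0) (𝓝 0) := by
      simpa [hσ0] using σ.continuous.tendsto 0
    exact this.eventually hΦN
  obtain ⟨δ, hδ, hδp⟩ := Metric.eventually_nhds_iff_ball.1 (hb.and hc)
  have hUsmall : ∀ᶠ x in 𝓝 (0 : E), ‖U x‖ < δ := by
    have := hUan.continuousAt.norm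
    rw [ContinuousAt, hU0, norm_zero] at this
    exact this.eventually (gt_mem_nhds hδ)
  have hxsmall : ∀ᶠ x in 𝓝 (0 : E), ‖x‖ < δ := by
    have := (continuous_norm (E := E)).continuousAt (x := 0)
    rw [ContinuousAt, norm_zero] at this
    exact this.eventually (gt_mem_nhds hδ)
  have hmem : ∀ (x : E) (V : C(unitInterval, W)), ‖x‖ < δ → ‖V‖ < δ →
      (x, V) ∈ Metric.ball (0 : E × C(unitInterval, W)) δ := by
    intro x V h1 h2
    rw [mem_ball_zero_iff]
    exact max_lt h1 h2
  -- The dilated path `τ ↦ U x (τ s)` solves the equation with parameter `s x`. Uniqueness in the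
  -- implicit function theorem identifies it with `U (s x)`, so the paths come from the single
  -- function `x ↦ U x 1`.
  have hray : ∀ᶠ x in 𝓝 (0 : E), ∀ s : unitInterval, U x s = U (((s : ℝ) : ℂ) • x) 1 := by
    filter_upwards [ha, hUsmall, hxsmall] with x hx hUx hxδ s
    set V : C(unitInterval, W) := (U x).comp ⟨fun τ => τ * s, by fun_prop⟩ with hV
    have hVn : ‖V‖ < δ := by
      refine lt_of_le_of_lt ((ContinuousMap.norm_le _ (norm_nonneg _)).2 fun t => ?_) hUx
      exact (U x).norm_coe_le_norm _
    have hsx : ‖((s : ℝ) : ℂ) • x‖ < δ := by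
      refine lt_of_le_of_lt ?_ hxδ
      simp only [norm_smul, Complex.norm_real, Real.norm_eq_abs, abs_of_nonneg s.2.1]
      exact mul_le_of_le_one_left (norm_nonneg _) s.2.2
    have hm1 := hδp _ (hmem _ _ hsx hVn)
    have hm2 := hδp _ (hmem _ _ hxδ hUx)
    have hfV : f (((s : ℝ) : ℂ) • x, V) = 0 := by
      ext τ
      have := congrArg (fun A : C(unitInterval, W) => A (τ * s)) hx
      simp only [hf, ContinuousMap.sub_apply, ContinuousMap.zero_apply, J, dilationOp_apply] at this ⊢
      rw [← this]
      congr 1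
      refine MeasureTheory.integral_congr_ae (Eventually.of_forall fun t => ?_)
      change M t (Φ (σ (_, V)) (t * τ)) = M t (Φ (σ (x, U x)) (t * (τ * s)))
      rw [hm1.2, hm2.2]
      simp only [σ, rayPath_apply, hV, ContinuousMap.comp_apply, ContinuousMap.coe_mk, smul_smul,
        mul_assoc, Set.Icc.coe_mul, Complex.ofReal_mul]
    have := congrArg (fun A : C(unitInterval, W) => A 1) (hm1.1 hfV)
    simp only [hV, ContinuousMap.comp_apply, ContinuousMap.coe_mk, one_mul] at this
    exact this.symm
  refine ⟨fun x => U x 1, ?_, by simp [hU0], ?_⟩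
  · exact ((ContinuousMap.evalCLM ℂ (1 : unitInterval) :
      C(unitInterval, W) →L[ℂ] W).analyticAt _).comp hUan
  · filter_upwards [ha, hUsmall, hxsmall, hray] with x hx hUx hxδ hr
    have := congrArg (fun A : C(unitInterval, W) => A 1) hx
    simp only [hf, ContinuousMap.sub_apply, ContinuousMap.zero_apply, J, dilationOp_apply,
      sub_eq_zero] at this
    rw [this]
    refine MeasureTheory.integral_congr_ae (Eventually.of_forall fun t => ?_)
    simp only [(hδp _ (hmem _ _ hxδ hUx)).2, σ, rayPath_apply, mul_one, hr t]

/-- A singular equation `Du(x) x = -(a₁ + 1) π₁ u - (a₂ + 1) π₂ u + N(x, u)` of Briot-Bouquet type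
with non-negative `a₁`, `a₂`, complementary projections `π₁`, `π₂` and `N` of second order in `u`
has an analytic solution that vanishes at the origin. -/
theorem exists_analytic_euler_solution {E W : Type*} [NormedAddCommGroup E] [NormedSpace ℂ E]
    [CompleteSpace E] [NormedAddCommGroup W] [NormedSpace ℂ W] [CompleteSpace W]
    (π₁ π₂ : W →L[ℂ] W) (h1 : ∀ u, π₁ u + π₂ u = u) (h12 : ∀ u, π₁ (π₂ u) = 0)
    (h21 : ∀ u, π₂ (π₁ u) = 0) {a₁ a₂ : ℝ} (ha₁ : 0 ≤ a₁) (ha₂ : 0 ≤ a₂)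
    {N : E × W → W} (hN : AnalyticAt ℂ N 0) (hN0 : N 0 = 0)
    (hD : ∀ v, fderiv ℂ N 0 (0, v) = 0) :
    ∃ u : E → W, AnalyticAt ℂ u 0 ∧ u 0 = 0 ∧
      ∀ᶠ x in 𝓝 0, fderiv ℂ u x x + ((a₁ + 1) • π₁ (u x) + (a₂ + 1) • π₂ (u x)) = N (x, u x) := by
  have h11 : ∀ u, π₁ (π₁ u) = π₁ u := fun u => by simpa [h21] using h1 (π₁ u)
  have h22 : ∀ u, π₂ (π₂ u) = π₂ u := fun u => by simpa [h12] using h1 (π₂ u)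
  let M : C(unitInterval, W →L[ℂ] W) :=
    ⟨fun t => (((t : ℝ) ^ a₁ : ℝ) : ℂ) • π₁ + (((t : ℝ) ^ a₂ : ℝ) : ℂ) • π₂, by
      have e1 : Continuous fun t : unitInterval => (t : ℝ) ^ a₁ :=
        (Real.continuous_rpow_const ha₁).comp continuous_subtype_val
      have e2 : Continuous fun t : unitInterval => (t : ℝ) ^ a₂ :=
        (Real.continuous_rpow_const ha₂).comp continuous_subtype_val
      fun_prop⟩
  obtain ⟨u, hu, hu0, hint⟩ := exists_analytic_integral_solution M hN hN0 hD
  refine ⟨u, hu, hu0, ?_⟩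
  set g : E → W := fun x => N (x, u x) with hg
  have hga : AnalyticAt ℂ g 0 := by
    refine AnalyticAt.comp (g := N) ?_ (analyticAt_id.prod hu)
    rwa [hu0]
  have hev : ∀ᶠ x in 𝓝 (0 : E), AnalyticAt ℂ g x ∧ AnalyticAt ℂ u x ∧
      u x = ∫ t : unitInterval, M t (g (((t : ℝ) : ℂ) • x)) :=
    hga.eventually_analyticAt.and (hu.eventually_analyticAt.and hint)
  obtain ⟨ε, hε, hball⟩ := Metric.eventually_nhds_iff_ball.1 hev
  filter_upwards [Metric.ball_mem_nhds (0 : E) hε] with x hx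
  rw [mem_ball_zero_iff] at hx
  -- The ray is prolonged slightly beyond `x`, so that the derivative at `s = 1` is two-sided.
  obtain ⟨r, hr1, hr⟩ : ∃ r : ℝ, 1 < r ∧ r * ‖x‖ < ε := by
    have : Tendsto (fun r : ℝ => r * ‖x‖) (𝓝[>] 1) (𝓝 (1 * ‖x‖)) :=
      (tendsto_id.mul_const _).mono_left nhdsWithin_le_nhds
    rw [one_mul] at this
    obtain ⟨r, h1, h2⟩ := ((this.eventually (gt_mem_nhds hx)).and self_mem_nhdsWithin).exists
    exact ⟨r, h2, h1⟩
  have hsmall : ∀ s ∈ Set.Ioo (-r) r, ((s : ℝ) : ℂ) • x ∈ Metric.ball (0 : E) ε := by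
    intro s hs
    rw [mem_ball_zero_iff, norm_smul, Complex.norm_real, Real.norm_eq_abs]
    refine lt_of_le_of_lt ?_ hr
    gcongr
    exact (abs_lt.2 hs).le
  have hgc : ContinuousOn (fun s : ℝ => g ((s : ℂ) • x)) (Set.Ioo (-r) r) := by
    intro s hs
    refine ContinuousAt.continuousWithinAt (ContinuousAt.comp (g := g)
      (hball _ (hsmall s hs)).1.continuousAt ?_)
    exact Continuous.continuousAt (by fun_prop)
  -- After projection the kernel `M t` is the scalar `t ^ a`, so each component satisfies a
  -- scalar-coefficient Euler equation along the ray.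
  have hpart : ∀ (π : W →L[ℂ] W) (a : ℝ), 0 ≤ a →
      (∀ (t : unitInterval) w, π (M t w) = ((t : ℝ) ^ a : ℝ) • π w) →
      HasDerivAt (fun s : ℝ => π (u ((s : ℂ) • x))) (π (g x) - (a + 1) • π (u x)) 1 := by
    intro π a ha hπ
    have hGc : ContinuousOn (fun s : ℝ => π (g ((s : ℂ) • x))) (Set.Ioo (-r) r) :=
      π.continuous.comp_continuousOn hgc
    have := hasDerivAt_integral_rpow_smul (v := fun s : ℝ => π (u ((s : ℂ) • x))) ha hr1 hGc ?_
    · simpa using this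
    filter_upwards [Ioo_mem_nhds (show -r < 1 by linarith) hr1, lt_mem_nhds zero_lt_one]
      with s hs hs0
    rw [(hball _ (hsmall s hs)).2.2, ← π.integral_comp_comm]
    · simp only [hπ, smul_smul]
      rw [intervalIntegral.integral_of_le zero_le_one, ← MeasureTheory.integral_Icc_eq_integral_Ioc]
      have := MeasureTheory.integral_subtype (s := unitInterval)
        measurableSet_Icc (fun t : ℝ => t ^ a • π (g (((t * s : ℝ) : ℂ) • x)))
      simp only [← Complex.ofReal_mul]
      exact this
    · have hc : Continuous fun t : unitInterval => g (((t : ℝ) : ℂ) • (s : ℂ) • x) := by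
        refine continuous_iff_continuousAt.2 fun t => ?_
        have hts : (t : ℝ) * s ∈ Set.Ioo (-r) r :=
          ⟨by nlinarith [mul_nonneg t.2.1 hs0.le], lt_of_le_of_lt
            (mul_le_of_le_one_left hs0.le t.2.2) hs.2⟩
        have := (hball _ (hsmall _ hts)).1.continuousAt
        rw [Complex.ofReal_mul, ← smul_smul] at this
        refine ContinuousAt.comp (g := g) this (Continuous.continuousAt (by fun_prop))
      exact (show Continuous fun t : unitInterval => M t (g (((t : ℝ) : ℂ) • (s : ℂ) • x)) from
        M.continuous.clm_apply hc).integrable_of_hasCompactSupport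
        (HasCompactSupport.of_compactSpace _)
  have hd1 := hpart π₁ a₁ ha₁ fun t w => by
    simp only [M, ContinuousMap.coe_mk, add_apply,
      smul_apply, map_add, map_smul, h11, h12, smul_zero, add_zero]
    exact Complex.coe_smul _ _
  have hd2 := hpart π₂ a₂ ha₂ fun t w => by
    simp only [M, ContinuousMap.coe_mk, add_apply,
      smul_apply, map_add, map_smul, h22, h21, smul_zero, zero_add]
    exact Complex.coe_smul _ _
  have hd := hd1.add hd2
  have hd' : HasDerivAt (fun s : ℝ => u ((s : ℂ) • x)) (fderiv ℂ u x x) 1 := by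
    have e1 : HasDerivAt (fun s : ℝ => (s : ℂ) • x) x 1 := by
      simpa using (Complex.ofRealCLM.hasDerivAt (x := 1)).smul_const x
    have e2 : HasFDerivAt u (fderiv ℂ u x) (((1 : ℝ) : ℂ) • x) := by
      simpa using (hball x (by simpa using hx)).2.1.differentiableAt.hasFDerivAt
    exact (e2.restrictScalars ℝ).comp_hasDerivAt 1 e1
  have heq : (fun s : ℝ => π₁ (u ((s : ℂ) • x))) + (fun s : ℝ => π₂ (u ((s : ℂ) • x)))
      = fun s : ℝ => u ((s : ℂ) • x) := by
    ext s
    exact h1 _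
  rw [heq] at hd
  rw [hd'.unique hd, ← h1 (N (x, u x))]
  abel

/-! ### Linearizing parametrizations of invariant manifolds. -/

/-- The pullback of the bilinear map `A` by the linear map `T`. -/
def bilinPullback {E V V' : Type*} [NormedAddCommGroup E] [NormedSpace ℂ E]
    [NormedAddCommGroup V] [NormedSpace ℂ V] [NormedAddCommGroup V'] [NormedSpace ℂ V']
    (A : V →L[ℂ] V →L[ℂ] V') (T : E →L[ℂ] V) : E →L[ℂ] E →L[ℂ] V' :=
  ((ContinuousLinearMap.compL ℂ E V V').flip T).comp (A.comp T)

@[simp] theorem bilinPullback_apply {E V V' : Type*} [NormedAddCommGroup E] [NormedSpace ℂ E]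
    [NormedAddCommGroup V] [NormedSpace ℂ V] [NormedAddCommGroup V'] [NormedSpace ℂ V']
    (A : V →L[ℂ] V →L[ℂ] V') (T : E →L[ℂ] V) (a b : E) :
    bilinPullback A T a b = A (T a) (T b) := rfl

theorem ContDiffAt.bilinPullback {P E V V' : Type*} [NormedAddCommGroup P] [NormedSpace ℂ P]
    [NormedAddCommGroup E] [NormedSpace ℂ E]
    [NormedAddCommGroup V] [NormedSpace ℂ V] [NormedAddCommGroup V'] [NormedSpace ℂ V']
    {n : WithTop ℕ∞} {A : P → V →L[ℂ] V →L[ℂ] V'} {T : P → E →L[ℂ] V} {p : P}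
    (hA : ContDiffAt ℂ n A p) (hT : ContDiffAt ℂ n T p) :
    ContDiffAt ℂ n (fun q => bilinPullback (A q) (T q)) p := by
  let C : (E →L[ℂ] V) →L[ℂ] (V →L[ℂ] V') →L[ℂ] E →L[ℂ] V' :=
    (ContinuousLinearMap.compL ℂ E V V').flip
  have hC : ContDiff ℂ n (fun S => C S) := by fun_prop
  have h : ContDiffAt ℂ n (fun q => C (T q)) p := hC.contDiffAt.comp p hT
  exact h.clm_comp (hA.clm_comp hT)

/-- The operator on bilinear maps given by composition with `P`. -/
def bilinPost {E V : Type*} [NormedAddCommGroup E] [NormedSpace ℂ E]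
    [NormedAddCommGroup V] [NormedSpace ℂ V] (P : V →L[ℂ] V) :
    (E →L[ℂ] E →L[ℂ] V) →L[ℂ] (E →L[ℂ] E →L[ℂ] V) :=
  ContinuousLinearMap.compL ℂ E (E →L[ℂ] V) (E →L[ℂ] V) (ContinuousLinearMap.compL ℂ E V V P)

@[simp] theorem bilinPost_apply {E V : Type*} [NormedAddCommGroup E] [NormedSpace ℂ E]
    [NormedAddCommGroup V] [NormedSpace ℂ V] (P : V →L[ℂ] V) (m : E →L[ℂ] E →L[ℂ] V) (a b : E) :
    bilinPost P m a b = P (m a b) := rfl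

/-- An auxiliary form of `exists_linearizing_parametrization`: the space of bilinear maps is
replaced by an isomorphic space `W`. -/
theorem exists_linearizing_parametrization_of_equiv {E V W : Type*}
    [NormedAddCommGroup E] [NormedSpace ℂ E] [CompleteSpace E]
    [NormedAddCommGroup V] [NormedSpace ℂ V] [CompleteSpace V]
    [NormedAddCommGroup W] [NormedSpace ℂ W] [CompleteSpace W] (e : W →L[ℂ] E →L[ℂ] E →L[ℂ] V)
    (e' : (E →L[ℂ] E →L[ℂ] V) →L[ℂ] W) (he' : ∀ m, e (e' m) = m) (he : ∀ w, e' (e w) = w)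
    (ι : E →L[ℂ] V) (P₁ P₂ : V →L[ℂ] V) (h1 : ∀ v, P₁ v + P₂ v = v) (h12 : ∀ v, P₁ (P₂ v) = 0)
    (h21 : ∀ v, P₂ (P₁ v) = 0) (hι : ∀ w, P₁ (ι w) = ι w)
    {X : V → V} (hX : AnalyticAt ℂ X 0) (hX0 : X 0 = 0) {l : ℂ} (hl : l ≠ 0) {β : ℝ}
    (hβ : β ≤ 1) (hd : ∀ v, fderiv ℂ X 0 v = l • (P₁ v + (β : ℂ) • P₂ v)) :
    ∃ K : E → V, AnalyticAt ℂ K 0 ∧ K 0 = 0 ∧ fderiv ℂ K 0 = ι ∧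
      ∀ᶠ w in 𝓝 0, fderiv ℂ K w (l • w) = X (K w) := by
  have hι2 : ∀ w, P₂ (ι w) = 0 := fun w => by simpa [hι] using h1 (ι w)
  have h11 : ∀ v, P₁ (P₁ v) = P₁ v := fun u => by simpa [h21] using h1 (P₁ u)
  have h22 : ∀ v, P₂ (P₂ v) = P₂ v := fun u => by simpa [h12] using h1 (P₂ u)
  set B : V →L[ℂ] V := P₁ + (β : ℂ) • P₂ with hBdef
  have hB : ∀ v, B v = P₁ v + (β : ℂ) • P₂ v := fun v => rfl
  obtain ⟨L, hL, hL0, hRL⟩ := AnalyticAt.exists_eq_clm_apply (f := fun v => l⁻¹ • X v - B v)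
    ((hX.const_smul (c := l⁻¹)).sub (B.analyticAt 0)) (by simp [hX0])
  have hL0' : L 0 = 0 := by
    rw [hL0]
    have := (hX.differentiableAt.hasFDerivAt.const_smul l⁻¹).sub (B.hasFDerivAt (x := 0))
    refine this.fderiv.trans ?_
    ext v
    simp [hd, hB, smul_smul, hl]
  obtain ⟨Q, hQ, -, hLQ⟩ := hL.exists_eq_clm_apply hL0'
  have hR : ∀ᶠ v in 𝓝 (0 : V), X v = l • (B v + Q v v v) := by
    filter_upwards [hRL, hLQ] with v h1 h2
    rw [← h2, ← h1, add_sub_cancel, smul_smul, mul_inv_cancel₀ hl, one_smul]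
  set π₁ : W →L[ℂ] W := e'.comp ((bilinPost P₁).comp e) with hπ₁
  set π₂ : W →L[ℂ] W := e'.comp ((bilinPost P₂).comp e) with hπ₂
  have hp1 : ∀ m a b, e (π₁ m) a b = P₁ (e m a b) := fun m a b => by simp [hπ₁, he']
  have hp2 : ∀ m a b, e (π₂ m) a b = P₂ (e m a b) := fun m a b => by simp [hπ₂, he']
  have hext : ∀ m m' : W, (∀ a b, e m a b = e m' a b) → m = m' := fun m m' h =>
    (Function.LeftInverse.injective he) (ContinuousLinearMap.ext fun a =>
      ContinuousLinearMap.ext fun b => h a b)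
  have hce : ContDiff ℂ ⊤ (fun w => e w) := by fun_prop
  have hde : ∀ w, HasFDerivAt (fun w => e w) e w := fun w => e.hasFDerivAt
  set q₀ : W := e' (bilinPullback (Q 0) ι) with hq₀
  -- The value `m(0)`: it solves `(2 - B) c = q₀`, where `2 - B` is `1` on the range of `P₁` and `2
  -- - β` on that of `P₂`.
  set c : W := π₁ q₀ + ((2 - β : ℝ) : ℂ)⁻¹ • π₂ q₀ with hc
  set T : E × W → (E →L[ℂ] V) := fun p => ι + e (c + p.2) p.1 with hTdef
  have hT0 : ∀ u, T (0, u) = ι := fun u => by simp [T]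
  -- Here `T p p.1` is the point `K w` when `p = (w, u w)`. Subtracting `q₀` makes `N` vanish on all
  -- of `{0} × W`, hence also its derivative in the `W` direction.
  set N : E × W → W := fun p => e' (bilinPullback (Q (T p p.1)) (T p)) - q₀ with hNdef
  have hN0 : ∀ u, N (0, u) = 0 := fun u => by
    simp only [N, hT0, hq₀, map_zero, sub_self]
  have hN : AnalyticAt ℂ N 0 := by
    have hec : ContDiffAt ℂ ⊤ (fun p : E × W => e (c + p.2)) 0 :=
      ContDiffAt.comp (g := fun w => e w) 0 hce.contDiffAt (contDiffAt_const.add contDiffAt_snd)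
    have hT : ContDiffAt ℂ ⊤ T 0 := contDiffAt_const.add (hec.clm_apply contDiffAt_fst)
    have hQT : ContDiffAt ℂ ⊤ (fun p : E × W => Q (T p p.1)) 0 := by
      refine ContDiffAt.comp (g := Q) 0 ?_ (hT.clm_apply contDiffAt_fst)
      simpa using hQ.contDiffAt
    exact ContDiffAt.analyticAt ((e'.contDiff.contDiffAt.comp 0
      (hQT.bilinPullback hT)).sub contDiffAt_const)
  have hDN : ∀ v, fderiv ℂ N 0 (0, v) = 0 := by
    intro v
    have h1 : HasFDerivAt (fun u => N (0, u)) ((fderiv ℂ N 0).comp (.inr ℂ E _)) 0 :=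
      HasFDerivAt.comp (g := N) 0 hN.differentiableAt.hasFDerivAt
        (ContinuousLinearMap.inr ℂ E W).hasFDerivAt
    have h2 : HasFDerivAt (fun u => N (0, u)) (0 : W →L[ℂ] W) 0 := by
      simp only [hN0]
      exact hasFDerivAt_const _ _
    exact congrArg (fun A => A v) (h1.unique h2)
  -- Differentiating the two explicit factors `w` contributes `2 m`, and `B` removes `1` or `β`.
  -- Thus `a₁ + 1 = 2 - 1` and `a₂ + 1 = 2 - β`, and `β ≤ 1` is exactly `a₂ ≥ 0`.
  obtain ⟨u, hu, hu0, hueq⟩ := exists_analytic_euler_solution π₁ π₂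
    (fun m => hext _ _ fun a b => by simp [hp1, hp2, h1])
    (fun m => hext _ _ fun a b => by simp [hp1, hp2, h12])
    (fun m => hext _ _ fun a b => by simp [hp1, hp2, h21])
    le_rfl (sub_nonneg.2 hβ) hN (hN0 0) hDN
  set K : E → V := fun w => ι w + e (c + u w) w w with hKdef
  have hK : ∀ w, K w = T (w, u w) w := fun w => by simp [K, T]
  have hder : ∀ w, DifferentiableAt ℂ u w → HasFDerivAt K (ι +
      (e (c + u w) w + ((e (c + u w)).flip w +
        ((e.comp (fderiv ℂ u w)).flip w).flip w))) w := by
    intro w hw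
    have hm : HasFDerivAt (fun x => e (c + u x)) (e.comp (fderiv ℂ u w)) w :=
      HasFDerivAt.comp (g := fun w => e w) w (hde _) (hw.hasFDerivAt.const_add c)
    have := ι.hasFDerivAt (x := w) |>.add
      ((hm.clm_apply (hasFDerivAt_id w)).clm_apply (hasFDerivAt_id w))
    refine this.congr_fderiv ?_
    ext h
    simp
  have hKa : AnalyticAt ℂ K 0 := by
    have hec : ContDiffAt ℂ ⊤ (fun w : E => e (c + u w)) 0 :=
      ContDiffAt.comp (g := fun w => e w) 0 hce.contDiffAt (contDiffAt_const.add hu.contDiffAt)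
    exact (ι.contDiff.contDiffAt.add ((hec.clm_apply contDiffAt_id).clm_apply
      contDiffAt_id)).analyticAt
  have hK0 : K 0 = 0 := by simp [K]
  refine ⟨K, hKa, hK0, ?_, ?_⟩
  · rw [(hder 0 hu.differentiableAt).fderiv]
    ext h
    simp
  have hRK : ∀ᶠ w in 𝓝 (0 : E), X (K w) = l • (B (K w) + Q (K w) (K w) (K w)) := by
    have := hKa.continuousAt
    rw [ContinuousAt, hK0] at this
    exact this.eventually hR
  have hβ2 : (2 - (β : ℂ)) ≠ 0 := by
    rw [← Complex.ofReal_ofNat, ← Complex.ofReal_sub, Ne, Complex.ofReal_eq_zero]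
    linarith
  filter_upwards [hRK, hueq, hu.eventually_analyticAt] with w hXw huw hua
  rw [hXw, map_smul, (hder w hua.differentiableAt).fderiv]
  congr 1
  have hSw : Q (K w) (K w) (K w) = e (N (w, u w)) w w + e q₀ w w := by
    simp [N, hK, he']
  have hsplit : ∀ v, v = P₁ v + P₂ v := fun v => (h1 v).symm
  rw [hSw, ← huw, hB]
  simp only [K, hc, map_add, map_smul, add_apply, smul_apply, hp1, hp2,
    ContinuousLinearMap.flip_apply, ContinuousLinearMap.comp_apply, hι, hι2, h11, h22, h12, h21,
    ← Complex.coe_smul]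
  rw [hsplit (e (u w) w w), hsplit (e q₀ w w)]
  simp only [map_add, h11, h22, h12, h21]
  push_cast
  match_scalars <;> field_simp <;> ring

/-- A vector field whose linear part is `l` on the image of `ι` and `l β` on a complement, where
`β ≤ 1` is real, has an analytic invariant manifold tangent to the image of `ι`, parametrized so
that the field becomes linear. -/
theorem exists_linearizing_parametrization {E V : Type*}
    [NormedAddCommGroup E] [NormedSpace ℂ E] [CompleteSpace E]
    [NormedAddCommGroup V] [NormedSpace ℂ V] [CompleteSpace V]
    (ι : E →L[ℂ] V) (P₁ P₂ : V →L[ℂ] V) (h1 : ∀ v, P₁ v + P₂ v = v) (h12 : ∀ v, P₁ (P₂ v) = 0)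
    (h21 : ∀ v, P₂ (P₁ v) = 0) (hι : ∀ w, P₁ (ι w) = ι w)
    {X : V → V} (hX : AnalyticAt ℂ X 0) (hX0 : X 0 = 0) {l : ℂ} (hl : l ≠ 0) {β : ℝ}
    (hβ : β ≤ 1) (hd : ∀ v, fderiv ℂ X 0 v = l • (P₁ v + (β : ℂ) • P₂ v)) :
    ∃ K : E → V, AnalyticAt ℂ K 0 ∧ K 0 = 0 ∧ fderiv ℂ K 0 = ι ∧
      ∀ᶠ w in 𝓝 0, fderiv ℂ K w (l • w) = X (K w) :=
  exists_linearizing_parametrization_of_equiv (W := E →L[ℂ] E →L[ℂ] V) (.id ℂ _) (.id ℂ _)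
    (fun _ => rfl) (fun _ => rfl) ι P₁ P₂ h1 h12 h21 hι hX hX0 hl hβ hd

/-! ### Center manifolds as graphs, and isochrony. -/

/-- An analytic map of a Banach space that is tangent to the identity at the origin has an
analytic local inverse. -/
theorem AnalyticAt.exists_local_inverse {E : Type*} [NormedAddCommGroup E] [NormedSpace ℂ E]
    [CompleteSpace E] {κ : E → E} (hκ : AnalyticAt ℂ κ 0) (h0 : κ 0 = 0)
    (hd : fderiv ℂ κ 0 = .id ℂ E) :
    ∃ σ : E → E, AnalyticAt ℂ σ 0 ∧ σ 0 = 0 ∧ (∀ᶠ w in 𝓝 0, σ (κ w) = w) ∧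
      ∀ᶠ e in 𝓝 0, κ (σ e) = e := by
  have hc : ContDiffAt ℂ ⊤ κ 0 := hκ.contDiffAt
  have hf : HasFDerivAt κ ((ContinuousLinearEquiv.refl ℂ E : E ≃L[ℂ] E) : E →L[ℂ] E) 0 := by
    have := hκ.differentiableAt.hasFDerivAt
    rw [hd] at this
    exact this
  have hs := hc.hasStrictFDerivAt' hf (by simp)
  refine ⟨hc.localInverse hf (by simp), ?_, ?_, ?_, ?_⟩
  · have := hc.to_localInverse hf (by simp)
    rw [h0] at this
    exact this.analyticAt
  · have := hc.localInverse_apply_image hf (by simp)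
    rwa [h0] at this
  · exact hs.eventually_left_inverse
  · have := hs.eventually_right_inverse
    rwa [h0] at this

section CenterManifolds

variable {E E' : Type*} [NormedAddCommGroup E] [NormedSpace ℂ E]
  [NormedAddCommGroup E'] [NormedSpace ℂ E']

theorem hasFDerivAt_graphMap (L : (E × E') ≃L[ℂ] Phase) {h : E → E'} {e : E}
    (hh : DifferentiableAt ℂ h e) :
    HasFDerivAt (graphMap L h)
      ((L : (E × E') →L[ℂ] Phase).comp ((ContinuousLinearMap.id ℂ E).prod (fderiv ℂ h e))) e :=
  (L : (E × E') →L[ℂ] Phase).hasFDerivAt.comp e ((hasFDerivAt_id e).prodMk hh.hasFDerivAt)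

/-- The reduced vector field on a center manifold is conjugate to its linear part, so that all
solutions in the manifold have the same period if the linear part is a multiple `i ω` of the
identity. -/
theorem IsCenterManifold.hasIsochronousFamily [CompleteSpace E] [CompleteSpace E']
    (L : (E × E') ≃L[ℂ] Phase) {X : Phase → Phase}
    (hX : AnalyticAt ℂ X 0) (hX0 : X 0 = 0) {h : E → E'} (hh : IsCenterManifold X L h) {ω : ℝ}
    (hω : ω ≠ 0) (hlin : ∀ e, fderiv ℂ X 0 (L (e, 0)) = (Complex.I * ω) • L (e, 0)) :
    HasIsochronousFamily X L h (2 * Real.pi / |ω|) := by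
  set l : ℂ := Complex.I * ω with hl
  have hl0 : l ≠ 0 := by simp [hl, hω]
  set g := graphMap L h with hg
  have hg0 : g 0 = 0 := by simp [hg, graphMap, hh.map_zero]
  have hga : AnalyticAt ℂ g 0 :=
    ((L : (E × E') →L[ℂ] Phase).analyticAt _).comp (analyticAt_id.prod hh.analytic)
  have hX' : AnalyticAt ℂ X (g 0) := by rwa [hg0]
  let R : Phase →L[ℂ] E := (ContinuousLinearMap.fst ℂ E E').comp (L.symm : Phase →L[ℂ] E × E')
  have hR : ∀ e e', R (L (e, e')) = e := fun e e' => by simp [R]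
  set f : E → E := fun e => R (X (g e)) with hf
  have hfa : AnalyticAt ℂ f 0 := (R.analyticAt _).comp (hX'.comp hga)
  have hf0 : f 0 = 0 := by simp [hf, hg0, hX0]
  have hfd : ∀ v, fderiv ℂ f 0 v = l • (ContinuousLinearMap.id ℂ E v
      + ((0 : ℝ) : ℂ) • (0 : E →L[ℂ] E) v) := by
    intro v
    have e1 := hasFDerivAt_graphMap L hh.analytic.differentiableAt
    have e2 : HasFDerivAt X (fderiv ℂ X 0) (g 0) := by
      rw [hg0]
      exact (hg0 ▸ hX').differentiableAt.hasFDerivAt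
    have e3 : HasFDerivAt f _ 0 := R.hasFDerivAt.comp 0 (e2.comp 0 e1)
    rw [e3.fderiv]
    simp [hh.tangent, hlin, hR]
  -- The reduced field has no complementary directions: `P₂ = 0`, and `β = 0` is an arbitrary
  -- admissible value.
  obtain ⟨κ, hκ, hκ0, hκd, hκeq⟩ := exists_linearizing_parametrization
    (.id ℂ E) (.id ℂ E) (0 : E →L[ℂ] E) (fun v => by simp) (fun v => by simp) (fun v => by simp)
    (fun v => by simp) hfa hf0 hl0 zero_le_one hfd
  obtain ⟨σ, hσ, hσ0, hσκ, hκσ⟩ := hκ.exists_local_inverse hκ0 hκd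
  have hinv : ∀ᶠ e in 𝓝 (0 : E), DifferentiableAt ℂ g e ∧ X (g e) = fderiv ℂ g e (f e) := by
    filter_upwards [hh.invariant, hh.analytic.eventually_analyticAt] with e he hha
    have hd := hasFDerivAt_graphMap L hha.differentiableAt
    obtain ⟨v, hv⟩ := he
    refine ⟨hd.differentiableAt, ?_⟩
    have : f e = v := by
      simp only [hf]
      rw [← hv, hd.fderiv]
      simp [hR]
    rw [this, hv]
  intro W hW
  have hκt : Tendsto κ (𝓝 0) (𝓝 0) := by
    simpa [ContinuousAt, hκ0] using hκ.continuousAt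
  have hσt : Tendsto σ (𝓝 0) (𝓝 0) := by
    simpa [ContinuousAt, hσ0] using hσ.continuousAt
  obtain ⟨ε, hε, hball⟩ := Metric.eventually_nhds_iff_ball.1
    (((hσκ.and hκeq).and hκ.eventually_analyticAt).and
      ((hκt.eventually hinv).and (hκt.eventually hW)))
  refine ⟨_, (hσt.eventually (Metric.ball_mem_nhds (0 : E) hε)).and hκσ, ?_⟩
  rintro e ⟨he, hκe⟩ he0
  set w := σ e with hw
  have hw0 : w ≠ 0 := by
    intro h0
    rw [h0, hκ0] at hκe
    exact he0 hκe.symm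
  -- Since `l` is purely imaginary, the linear flow preserves the norm; the orbit stays in the
  -- domain of the conjugacy for all times.
  have hmem : ∀ t : ℝ, Complex.exp (t * l) • w ∈ Metric.ball (0 : E) ε := by
    intro t
    have : ‖Complex.exp (t * l)‖ = 1 := by
      rw [hl, show (t : ℂ) * (Complex.I * ω) = ((t * ω : ℝ) : ℂ) * Complex.I by push_cast; ring]
      exact Complex.norm_exp_ofReal_mul_I _
    rw [mem_ball_zero_iff, norm_smul, this, one_mul]
    exact mem_ball_zero_iff.1 he
  have hper : ∀ t : ℝ, Complex.exp (((t + 2 * Real.pi / |ω| : ℝ) : ℂ) * l)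
      = Complex.exp (t * l) := by
    intro t
    rcases abs_choice ω with h1 | h1 <;> rw [h1, hl, Complex.exp_eq_exp_iff_exists_int]
    · refine ⟨1, ?_⟩
      have : (ω : ℂ) ≠ 0 := by exact_mod_cast hω
      push_cast
      field_simp
    · refine ⟨-1, ?_⟩
      have : (ω : ℂ) ≠ 0 := by exact_mod_cast hω
      push_cast
      field_simp
  refine ⟨fun t => g (κ (Complex.exp (t * l) • w)), ?_, ⟨?_, ?_, ?_, ?_⟩, ?_⟩
  · simp [hκe, hg]
  · intro t
    obtain ⟨⟨⟨-, h2⟩, h3⟩, ⟨h4, h5⟩, -⟩ := hball _ (hmem t)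
    have d1 : HasDerivAt (fun t : ℝ => Complex.exp (t * l) • w)
        (l • Complex.exp (t * l) • w) t := by
      have : HasDerivAt (fun t : ℝ => Complex.exp (t * l)) (Complex.exp (t * l) * l) t := by
        have h0 : HasDerivAt (fun t : ℝ => (t : ℂ) * l) l t := by
          simpa using (Complex.ofRealCLM.hasDerivAt (x := t)).mul_const l
        exact h0.cexp
      have h1 := this.smul_const w
      rwa [mul_comm, ← smul_smul] at h1
    have d2 := (h3.differentiableAt.hasFDerivAt.restrictScalars ℝ).comp_hasDerivAt t d1
    have d3 := (h4.hasFDerivAt.restrictScalars ℝ).comp_hasDerivAt t d2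
    rw [h5, ← h2]
    exact d3
  · have := abs_pos.2 hω
    positivity
  · intro t
    simp only [hper]
  -- Injectivity of the graph map and of `κ` near `0` reduces a period to `exp(T l) = 1`, so `T |ω|`
  -- is a non-zero multiple of `2 π`.
  · intro T hT hTper
    have h1 := hTper 0
    have hginj : Function.Injective g := fun a b hab => by
      have := congrArg R hab
      simpa [hg, graphMap, hR] using this
    have h2 := hginj h1
    have h3 := congrArg σ h2
    rw [(hball _ (hmem _)).1.1.1, (hball _ (hmem _)).1.1.1] at h3
    have h4 := smul_left_injective ℂ hw0 h3
    simp only [zero_add, Complex.ofReal_zero, zero_mul, Complex.exp_zero] at h4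
    obtain ⟨n, hn⟩ := Complex.exp_eq_one_iff.1 h4
    have h5 : T * ω = n * (2 * Real.pi) := by
      have : ((T * ω : ℝ) : ℂ) = ((n * (2 * Real.pi) : ℝ) : ℂ) := by
        apply mul_right_cancel₀ Complex.I_ne_zero
        push_cast
        rw [hl] at hn
        linear_combination hn
      exact_mod_cast this
    have hn0 : n ≠ 0 := by
      rintro rfl
      simp [hT.ne', hω] at h5
    have h6 : T * |ω| = |(n : ℝ)| * (2 * Real.pi) := by
      have := congrArg abs h5
      rwa [abs_mul, abs_mul, abs_of_pos hT, abs_of_pos Real.two_pi_pos] at this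
    have h7 : (1 : ℝ) ≤ |(n : ℝ)| := by exact_mod_cast Int.one_le_abs hn0
    rw [div_le_iff₀ (abs_pos.2 hω), h6]
    nlinarith [Real.two_pi_pos]
  · intro t
    exact ⟨_, (hball _ (hmem t)).2.2, rfl⟩

/-- A center manifold exists over `E` if the linear part is `l` on `E` and `l β` on `E'`, where
`β ≤ 1` is real. -/
theorem exists_isCenterManifold [CompleteSpace E] [CompleteSpace E']
    (L : (E × E') ≃L[ℂ] Phase) {X : Phase → Phase}
    (hX : AnalyticAt ℂ X 0) (hX0 : X 0 = 0) {l : ℂ} (hl : l ≠ 0) {β : ℝ} (hβ : β ≤ 1)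
    (hlin : ∀ e e', fderiv ℂ X 0 (L (e, e')) = L (l • e, (l * β) • e')) :
    ∃ h : E → E', IsCenterManifold X L h := by
  set Y : E × E' → E × E' := fun v => L.symm (X (L v)) with hY
  have hX' : AnalyticAt ℂ X (L 0) := by rwa [map_zero]
  have hYa : AnalyticAt ℂ Y 0 := ((L.symm : Phase →L[ℂ] E × E').analyticAt _).comp
    (hX'.comp ((L : (E × E') →L[ℂ] Phase).analyticAt _))
  have hY0 : Y 0 = 0 := by simp [hY, hX0]
  let P₁ : (E × E') →L[ℂ] E × E' := (ContinuousLinearMap.inl ℂ E E').comp (.fst ℂ E E')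
  let P₂ : (E × E') →L[ℂ] E × E' := (ContinuousLinearMap.inr ℂ E E').comp (.snd ℂ E E')
  have hYd : ∀ v, fderiv ℂ Y 0 v = l • (P₁ v + (β : ℂ) • P₂ v) := by
    intro v
    have e2 : HasFDerivAt X (fderiv ℂ X 0) (L 0) := by
      rw [map_zero]
      exact hX.differentiableAt.hasFDerivAt
    have e3 : HasFDerivAt Y _ 0 := (L.symm : Phase →L[ℂ] E × E').hasFDerivAt.comp 0
      (e2.comp 0 (L : (E × E') →L[ℂ] Phase).hasFDerivAt)
    rw [e3.fderiv]
    have := hlin v.1 v.2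
    simp [this, P₁, P₂, mul_smul]
  obtain ⟨K, hK, hK0, hKd, hKeq⟩ := exists_linearizing_parametrization
    (.inl ℂ E E') P₁ P₂ (fun v => by simp [P₁, P₂]) (fun v => by simp [P₁, P₂])
    (fun v => by simp [P₁, P₂]) (fun v => by simp [P₁]) hYa hY0 hl hβ hYd
  set κ : E → E := fun w => (K w).1 with hκdef
  have hκ : AnalyticAt ℂ κ 0 := ((ContinuousLinearMap.fst ℂ E E').analyticAt _).comp hK
  have hκ0 : κ 0 = 0 := by simp [hκdef, hK0]
  have hκd : fderiv ℂ κ 0 = .id ℂ E := by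
    have : HasFDerivAt κ _ 0 :=
      (ContinuousLinearMap.fst ℂ E E').hasFDerivAt.comp 0 hK.differentiableAt.hasFDerivAt
    rw [this.fderiv, hKd]
    rfl
  -- The base component of `K` is tangent to the identity; inverting it rewrites the parametrized
  -- manifold as a graph.
  obtain ⟨σ, hσ, hσ0, hσκ, hκσ⟩ := hκ.exists_local_inverse hκ0 hκd
  set h : E → E' := fun e => (K (σ e)).2 with hh
  have hKσ : AnalyticAt ℂ K (σ 0) := by rwa [hσ0]
  have hha : AnalyticAt ℂ h 0 :=
    ((ContinuousLinearMap.snd ℂ E E').analyticAt _).comp (hKσ.comp hσ)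
  refine ⟨h, hha, by simp [hh, hσ0, hK0], ?_, ?_⟩
  · have e1 : HasFDerivAt K (.inl ℂ E E') (σ 0) := by
      rw [hσ0, ← hKd]
      exact hK.differentiableAt.hasFDerivAt
    have : HasFDerivAt h _ 0 := (ContinuousLinearMap.snd ℂ E E').hasFDerivAt.comp 0
      (e1.comp 0 hσ.differentiableAt.hasFDerivAt)
    rw [this.fderiv]
    ext v
    simp
  have hκt : Tendsto κ (𝓝 0) (𝓝 0) := by
    simpa [ContinuousAt, hκ0] using hκ.continuousAt
  have hσt : Tendsto σ (𝓝 0) (𝓝 0) := by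
    simpa [ContinuousAt, hσ0] using hσ.continuousAt
  have hcomp : ∀ᶠ w in 𝓝 (0 : E), (fun w => graphMap L h (κ w)) =ᶠ[𝓝 w] fun w => L (K w) := by
    refine eventually_eventually_nhds.2 ?_
    filter_upwards [hσκ] with w hw
    change L (κ w, (K (σ (κ w))).2) = L (K w)
    rw [hw]
  have hkey : ∀ᶠ w in 𝓝 (0 : E),
      X (graphMap L h (κ w)) ∈ Set.range (fderiv ℂ (graphMap L h) (κ w)) := by
    filter_upwards [hcomp, hKeq, hκ.eventually_analyticAt, hK.eventually_analyticAt,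
      hκt.eventually hha.eventually_analyticAt] with w h1 h2 h3 h4 h5
    have d1 := (hasFDerivAt_graphMap L h5.differentiableAt).differentiableAt.hasFDerivAt.comp w
      h3.differentiableAt.hasFDerivAt
    have d2 : HasFDerivAt (fun w => L (K w)) _ w := (L : (E × E') →L[ℂ] Phase).hasFDerivAt.comp w
      h4.differentiableAt.hasFDerivAt
    have d3 := (d2.congr_of_eventuallyEq h1).unique d1
    -- The reduced field at `κ w` is the image under `κ` of the linear field `l w`.
    refine ⟨fderiv ℂ κ w (l • w), ?_⟩
    have h6 := congrArg (fun A => A (l • w)) d3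
    simp only [ContinuousLinearMap.comp_apply, h2] at h6
    have h7 : graphMap L h (κ w) = L (K w) := h1.self_of_nhds
    rw [← h6, h7]
    simp [hY]
  filter_upwards [hσt.eventually hkey, hκσ] with e h1 h2
  rwa [h2] at h1

end CenterManifolds

/-! ### Blowing up the origin. -/

section BlowUp

variable {W : Type*} [NormedAddCommGroup W] [NormedSpace ℂ W]

/-- `f (x, x u, x v) / x` for vector-valued `f`, extended to `x = 0`. -/
def quotientBlowUp (f : Phase → W) (p : Phase) : W :=
  dslope (fun t : ℂ => f (t, t * p.2.1, t * p.2.2)) 0 p.1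

theorem quotientBlowUp_of_ne (f : Phase → W) (hf0 : f 0 = 0) {p : Phase} (hp : p.1 ≠ 0) :
    quotientBlowUp f p = p.1⁻¹ • f (p.1, p.1 • p.2) := by
  have : f (0, 0, 0) = 0 := hf0
  rw [quotientBlowUp, dslope_of_ne _ hp, slope_def_module]
  simp only [zero_mul, this, sub_zero]
  rfl

theorem quotientBlowUp_zero {f : Phase → W} (hf : DifferentiableAt ℂ f 0) (u : ℂ × ℂ) :
    quotientBlowUp f (0, u) = fderiv ℂ f 0 (1, u) := by
  rw [quotientBlowUp, dslope_same]
  have h1 : HasDerivAt (fun t : ℂ => (t, t * u.1, t * u.2)) ((1, u.1, u.2) : Phase) 0 := by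
    have h := hasDerivAt_id (0 : ℂ)
    simpa using h.prodMk ((h.mul_const u.1).prodMk (h.mul_const u.2))
  have h2 : HasFDerivAt f (fderiv ℂ f 0) ((0 : ℂ), (0 : ℂ) * u.1, (0 : ℂ) * u.2) := by
    simp only [zero_mul]
    exact hf.hasFDerivAt
  exact (h2.comp_hasDerivAt (0 : ℂ) h1).deriv

/-- By Hadamard's lemma `f(x, x u) = x L(x, x u)(1, u)`, and the factor after `x` is analytic across
`x = 0`. -/
theorem analyticAt_quotientBlowUp [CompleteSpace W] {f : Phase → W} (hf : AnalyticAt ℂ f 0)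
    (hf0 : f 0 = 0) (c : ℂ × ℂ) : AnalyticAt ℂ (quotientBlowUp f) (0, c) := by
  obtain ⟨L, hL, hL0, hfL⟩ := hf.exists_eq_clm_apply hf0
  have hs : ContDiff ℂ ⊤ (fun p : Phase => ((p.1, p.1 • p.2) : Phase)) := by fun_prop
  have hs0 : (((0, c) : Phase).1, ((0, c) : Phase).1 • ((0, c) : Phase).2) = (0 : Phase) := by simp
  have hLs : ContDiffAt ℂ ⊤ (fun p : Phase => L (p.1, p.1 • p.2)) (0, c) := by
    refine ContDiffAt.comp (g := L) (0, c) ?_ hs.contDiffAt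
    rw [hs0]
    exact hL.contDiffAt
  have hg : ContDiffAt ℂ ⊤ (fun p : Phase => L (p.1, p.1 • p.2) (1, p.2)) (0, c) :=
    hLs.clm_apply (by fun_prop)
  refine hg.analyticAt.congr ?_
  have ht : Tendsto (fun p : Phase => ((p.1, p.1 • p.2) : Phase)) (𝓝 (0, c)) (𝓝 0) := by
    have := hs.continuous.tendsto (0, c)
    rwa [hs0] at this
  filter_upwards [ht.eventually hfL] with p hp
  obtain ⟨x, u⟩ := p
  by_cases hx : x = 0
  · subst hx
    rw [quotientBlowUp_zero hf.differentiableAt, ← hL0]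
    simp
    rfl
  · rw [quotientBlowUp_of_ne f hf0 hx, hp, ← map_smul]
    simp [hx]

end BlowUp

/-! ### Briot-Bouquet systems and their reduction. -/

/-- `x u' = B (x, u)` is a Briot-Bouquet system with linear part `q u + x p`. -/
structure IsBriotBouquet (B : Phase → ℂ × ℂ) (q : ℂ) : Prop where
  analytic : AnalyticAt ℂ B 0
  map_zero : B 0 = 0
  linear : ∀ u, fderiv ℂ B 0 (0, u) = q • u

/-- `φ` is an analytic solution of `x u' = B (x, u)` that vanishes at the origin. -/
structure IsBriotBouquetSolution (B : Phase → ℂ × ℂ) (φ : ℂ → ℂ × ℂ) : Prop where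
  analytic : AnalyticAt ℂ φ 0
  map_zero : φ 0 = 0
  solution : ∀ᶠ x in 𝓝 0, x • deriv φ x = B (x, φ x)

/-- The system that `x u' = B (x, u)` becomes under `u = x (ũ + c)`. -/
def shiftStep (c : ℂ × ℂ) (B : Phase → ℂ × ℂ) : Phase → ℂ × ℂ := fun w =>
  quotientBlowUp B (w.1, w.2 + c) - (w.2 + c)

theorem bbStep_eq_shiftStep (q : ℂ) (B : Phase → ℂ × ℂ) :
    bbStep q q B = shiftStep ((1 - q)⁻¹ • xCoeff B) B := by
  have : ((1 - q)⁻¹ • xCoeff B) = ((xCoeff B).1 / (1 - q), (xCoeff B).2 / (1 - q)) := by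
    ext <;> simp [div_eq_inv_mul]
  rw [this]
  rfl

theorem xCoeff_eq {B : Phase → ℂ × ℂ} (hB : DifferentiableAt ℂ B 0) :
    xCoeff B = fderiv ℂ B 0 (1, 0) := by
  have h1 : HasDerivAt (fun t : ℂ => (t, (0 : ℂ), (0 : ℂ))) ((1, 0) : Phase) 0 :=
    (hasDerivAt_id (0 : ℂ)).prodMk (hasDerivAt_const _ _)
  exact (HasFDerivAt.comp_hasDerivAt (l := B) (0 : ℂ) hB.hasFDerivAt h1).deriv

namespace IsBriotBouquet

variable {B : Phase → ℂ × ℂ} {q : ℂ}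

theorem fderiv_apply (hB : IsBriotBouquet B q) (x : ℂ) (u : ℂ × ℂ) :
    fderiv ℂ B 0 (x, u) = x • xCoeff B + q • u := by
  have : ((x, u) : Phase) = x • ((1, 0) : Phase) + (0, u) := by ext <;> simp
  rw [this, map_add, map_smul, hB.linear, xCoeff_eq hB.analytic.differentiableAt]

/-- Blown-up systems are exactly linear in `u` on `x = 0`, which makes this criterion convenient for
them. -/
theorem of_apply_zero (hB : AnalyticAt ℂ B 0) (h : ∀ u, B (0, u) = q • u) :
    IsBriotBouquet B q := by
  refine ⟨hB, (h 0).trans (smul_zero q), fun u => ?_⟩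
  have h1 : HasFDerivAt (fun u : ℂ × ℂ => B (0, u)) ((fderiv ℂ B 0).comp (.inr ℂ ℂ (ℂ × ℂ))) 0 :=
    HasFDerivAt.comp (g := B) 0 hB.differentiableAt.hasFDerivAt
      (ContinuousLinearMap.inr ℂ ℂ (ℂ × ℂ)).hasFDerivAt
  have h2 : HasFDerivAt (fun u : ℂ × ℂ => B (0, u)) (q • ContinuousLinearMap.id ℂ (ℂ × ℂ)) 0 := by
    simp only [h]
    exact (q • ContinuousLinearMap.id ℂ (ℂ × ℂ)).hasFDerivAt
  exact congrArg (fun A => A u) (h1.unique h2)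

/-- On `x = 0` the new right-hand side is `xCoeff B + (q - 1)(u + c)`, and `hc` removes the
constant. Allowing any such `c`, rather than only `xCoeff B / (1 - q)`, covers `q = 1` with
vanishing coefficient, where `c` is free. -/
theorem shiftStep (hB : IsBriotBouquet B q) {c : ℂ × ℂ} (hc : xCoeff B + (q - 1) • c = 0) :
    IsBriotBouquet (shiftStep c B) (q - 1) := by
  refine of_apply_zero ?_ fun u => ?_
  · have h1 : AnalyticAt ℂ (fun w : Phase => ((w.1, w.2 + c) : Phase)) 0 :=
      analyticAt_fst.prod (analyticAt_snd.add analyticAt_const)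
    have h2 : AnalyticAt ℂ (quotientBlowUp B)
        ((fun w : Phase => ((w.1, w.2 + c) : Phase)) 0) := by
      simpa using analyticAt_quotientBlowUp hB.analytic hB.map_zero c
    exact AnalyticAt.sub (AnalyticAt.comp (f := fun w : Phase => ((w.1, w.2 + c) : Phase)) h2 h1)
      (analyticAt_snd.add analyticAt_const)
  · simp only [_root_.shiftStep]
    rw [quotientBlowUp_zero hB.analytic.differentiableAt, hB.fderiv_apply]
    linear_combination (norm := module) hc

/-- In one variable `x φ'` is `Dφ(x) x`, so this is the singular equation with `a₁ + 1 = -q`; the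
second projection is zero. -/
theorem exists_solution_of_le (q : ℝ) (hB : IsBriotBouquet B q) (hq : q ≤ -1) :
    ∃ φ, IsBriotBouquetSolution B φ := by
  set N : Phase → ℂ × ℂ := fun p => B p - (q : ℂ) • p.2 with hN
  have hNa : AnalyticAt ℂ N 0 := hB.analytic.sub (analyticAt_snd.const_smul (c := (q : ℂ)))
  have hNd : ∀ v, fderiv ℂ N 0 (0, v) = 0 := by
    intro v
    have : HasFDerivAt N _ 0 := hB.analytic.differentiableAt.hasFDerivAt.sub
      ((hasFDerivAt_snd (𝕜 := ℂ) (p := (0 : Phase))).const_smul (q : ℂ))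
    rw [this.fderiv]
    simp [hB.linear]
  obtain ⟨u, hu, hu0, hueq⟩ := exists_analytic_euler_solution (.id ℂ (ℂ × ℂ)) 0
    (fun v => by simp) (fun v => by simp) (fun v => by simp)
    (show (0 : ℝ) ≤ -q - 1 by linarith) le_rfl hNa (by simp [hN, hB.map_zero]) hNd
  refine ⟨u, hu, hu0, ?_⟩
  filter_upwards [hueq] with x hx
  have h1 : fderiv ℂ u x x = x • deriv u x := by simp
  rw [h1] at hx
  have h2 : (-q - 1 + 1) • u x = -((q : ℂ) • u x) := by
    rw [Complex.coe_smul, sub_add_cancel, neg_smul]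
  simp only [hN, ContinuousLinearMap.id_apply, h2, zero_apply, smul_zero, add_zero] at hx
  simpa [sub_eq_add_neg] using hx

end IsBriotBouquet

namespace IsBriotBouquetSolution

variable {B : Phase → ℂ × ℂ}

theorem of_shiftStep (hB0 : B 0 = 0) {c : ℂ × ℂ} {φ : ℂ → ℂ × ℂ}
    (hφ : IsBriotBouquetSolution (shiftStep c B) φ) :
    IsBriotBouquetSolution B fun x => x • (φ x + c) := by
  refine ⟨analyticAt_id.smul (hφ.analytic.add analyticAt_const), zero_smul _ _, ?_⟩
  filter_upwards [hφ.solution, hφ.analytic.eventually_analyticAt] with x h1 h2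
  by_cases hx : x = 0
  · subst hx
    simp only [zero_smul]
    exact hB0.symm
  have hd : HasDerivAt (fun x => x • (φ x + c)) (x • deriv φ x + (1 : ℂ) • (φ x + c)) x :=
    (hasDerivAt_id x).smul (h2.differentiableAt.hasDerivAt.add_const c)
  rw [hd.deriv, h1, shiftStep, quotientBlowUp_of_ne B hB0 hx]
  simp [smul_smul, hx]

/-- Comparison of the derivatives at `0` of the two sides of the equation. For `q ≠ 1` it determines
the slope of a solution; for `q = 1` it is the obstruction to existence. -/
theorem deriv_zero {q : ℂ} (hB : IsBriotBouquet B q) {ψ : ℂ → ℂ × ℂ}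
    (hψ : IsBriotBouquetSolution B ψ) : xCoeff B + (q - 1) • deriv ψ 0 = 0 := by
  have h1 : HasDerivAt (fun x => x • deriv ψ x) ((0 : ℂ) • deriv (deriv ψ) 0
      + (1 : ℂ) • deriv ψ 0) 0 :=
    (hasDerivAt_id (0 : ℂ)).smul hψ.analytic.deriv.differentiableAt.hasDerivAt
  have h2 : HasDerivAt (fun x => B (x, ψ x)) (fderiv ℂ B 0 (1, deriv ψ 0)) 0 := by
    refine HasFDerivAt.comp_hasDerivAt (l := B) (0 : ℂ) ?_
      ((hasDerivAt_id (0 : ℂ)).prodMk hψ.analytic.differentiableAt.hasDerivAt)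
    rw [hψ.map_zero]
    exact hB.analytic.differentiableAt.hasFDerivAt
  have h3 := (h2.congr_of_eventuallyEq hψ.solution).unique h1
  rw [hB.fderiv_apply] at h3
  simp only [one_smul, zero_smul, zero_add] at h3
  linear_combination (norm := module) h3

/-- Converse to `of_shiftStep`. The shift has to be the slope of `ψ`, since the new unknown must
vanish at `0`. -/
theorem shiftStep_dslope (hB : B 0 = 0) {ψ : ℂ → ℂ × ℂ} (hψ : IsBriotBouquetSolution B ψ)
    (h0 : shiftStep (deriv ψ 0) B 0 = 0) :
    IsBriotBouquetSolution (shiftStep (deriv ψ 0) B) fun x => dslope ψ 0 x - deriv ψ 0 := by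
  have hda : AnalyticAt ℂ (dslope ψ 0) 0 := by
    obtain ⟨p, hp⟩ := hψ.analytic
    exact hp.has_fpower_series_dslope_fslope.analyticAt
  have hψx : ∀ x, ψ x = x • dslope ψ 0 x := fun x => by
    have := sub_smul_dslope ψ 0 x
    rw [hψ.map_zero, sub_zero, sub_zero] at this
    exact this.symm
  refine ⟨hda.sub analyticAt_const, by simp, ?_⟩
  filter_upwards [hψ.solution, hda.eventually_analyticAt] with x h1 h2
  by_cases hx : x = 0
  · subst hx
    simp only [zero_smul, dslope_same, sub_self]
    exact h0.symm
  have hd : HasDerivAt ψ (x • deriv (dslope ψ 0) x + (1 : ℂ) • dslope ψ 0 x) x := by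
    have := (hasDerivAt_id x).smul h2.differentiableAt.hasDerivAt
    exact this.congr_of_eventuallyEq (Eventually.of_forall hψx)
  rw [hd.deriv] at h1
  simp only [deriv_sub_const, shiftStep, sub_add_cancel]
  rw [quotientBlowUp_of_ne B hB hx, ← hψx, ← h1, smul_smul, inv_mul_cancel₀ hx, one_smul, one_smul,
    add_sub_cancel_right]

end IsBriotBouquetSolution

namespace IsBriotBouquet

/-- Each reduction lowers `q` and `n` by one. Excluding positive integers keeps `q ≠ 1` at every
stage, and `n = 0` is the range `q ≤ -1`. -/
theorem exists_solution (n : ℕ) : ∀ {B : Phase → ℂ × ℂ} {q : ℝ}, IsBriotBouquet B q →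
    (∀ k : ℕ, q ≠ k + 1) → q ≤ n - 1 → ∃ φ, IsBriotBouquetSolution B φ := by
  induction n with
  | zero =>
    intro B q hB _ hq
    exact exists_solution_of_le q hB (by simpa using hq)
  | succ n ih =>
    intro B q hB hne hq
    have hq1 : (q : ℂ) - 1 ≠ 0 := by
      have := hne 0
      rw [sub_ne_zero]
      exact_mod_cast (by simpa using this)
    have hS := hB.shiftStep (c := -((q : ℂ) - 1)⁻¹ • xCoeff B) (by
      rw [smul_smul]
      field_simp
      module)
    rw [show (q : ℂ) - 1 = ((q - 1 : ℝ) : ℂ) by push_cast; rfl] at hS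
    obtain ⟨φ, hφ⟩ := ih hS (fun k hk => hne (k + 1) (by push_cast; linarith))
      (by push_cast at hq; linarith)
    exact ⟨_, hφ.of_shiftStep hB.map_zero⟩

theorem bbStep {B : Phase → ℂ × ℂ} {q : ℂ} (hB : IsBriotBouquet B q) (hq : q ≠ 1) :
    IsBriotBouquet (bbStep q q B) (q - 1) := by
  rw [bbStep_eq_shiftStep]
  refine hB.shiftStep ?_
  have : 1 - q ≠ 0 := sub_ne_zero.2 hq.symm
  rw [smul_smul, show (q - 1) * (1 - q)⁻¹ = -1 by field_simp; ring]
  module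

theorem bbIterate {B : Phase → ℂ × ℂ} {q : ℂ} (hB : IsBriotBouquet B q) (k : ℕ)
    (hq : ∀ j < k, q - j ≠ 1) : IsBriotBouquet (bbIterate q q B k) (q - k) := by
  induction k with
  | zero => simpa [_root_.bbIterate] using hB
  | succ k ih =>
    have := (ih fun j hj => hq j (by omega)).bbStep (hq k (by omega))
    simpa [_root_.bbIterate, sub_sub] using this

end IsBriotBouquet

/-- By `deriv_zero` the constant prescribed in `bbStep` is the slope of any solution, so every
solution survives the reduction. -/
theorem IsBriotBouquetSolution.exists_bbStep {B : Phase → ℂ × ℂ} {q : ℂ}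
    (hB : IsBriotBouquet B q) (hq : q ≠ 1) {ψ : ℂ → ℂ × ℂ} (hψ : IsBriotBouquetSolution B ψ) :
    ∃ φ, IsBriotBouquetSolution (bbStep q q B) φ := by
  have hc : (1 - q)⁻¹ • xCoeff B = deriv ψ 0 := by
    have h1 := hψ.deriv_zero hB
    have h2 : 1 - q ≠ 0 := sub_ne_zero.2 hq.symm
    rw [inv_smul_eq_iff₀ h2]
    linear_combination (norm := module) h1
  have h0 := (hB.bbStep hq).map_zero
  rw [bbStep_eq_shiftStep, hc] at h0 ⊢
  exact ⟨_, hψ.shiftStep_dslope hB.map_zero h0⟩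

theorem IsBriotBouquetSolution.exists_bbIterate {B : Phase → ℂ × ℂ} {q : ℂ}
    (hB : IsBriotBouquet B q) {ψ : ℂ → ℂ × ℂ} (hψ : IsBriotBouquetSolution B ψ) (k : ℕ)
    (hq : ∀ j < k, q - j ≠ 1) : ∃ φ, IsBriotBouquetSolution (bbIterate q q B k) φ := by
  induction k with
  | zero => exact ⟨ψ, hψ⟩
  | succ k ih =>
    obtain ⟨φ, hφ⟩ := ih fun j hj => hq j (by omega)
    exact hφ.exists_bbStep (hB.bbIterate k fun j hj => hq j (by omega)) (hq k (by omega))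

/-- The system `x u' = B (x, u)` has a family of solutions with pairwise different germs, indexed
by the complex numbers. -/
def HasSolutionFamily (B : Phase → ℂ × ℂ) : Prop :=
  ∃ Ψ : ℂ → ℂ → ℂ × ℂ, (∀ c, IsBriotBouquetSolution B (Ψ c)) ∧
    ∀ c c', Ψ c =ᶠ[𝓝 0] Ψ c' → c = c'

theorem eventuallyEq_of_smul_add {φ φ' : ℂ → ℂ × ℂ} (h0 : φ 0 = φ' 0) (c : ℂ × ℂ)
    (h : (fun x => x • (φ x + c)) =ᶠ[𝓝 0] fun x => x • (φ' x + c)) : φ =ᶠ[𝓝 0] φ' := by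
  filter_upwards [h] with x hx
  by_cases hx0 : x = 0
  · rw [hx0, h0]
  · exact add_right_cancel (smul_right_injective _ hx0 hx)

theorem HasSolutionFamily.of_shiftStep {B : Phase → ℂ × ℂ} (hB : B 0 = 0) (c : ℂ × ℂ)
    (h : HasSolutionFamily (shiftStep c B)) : HasSolutionFamily B := by
  obtain ⟨Ψ, h1, h2⟩ := h
  refine ⟨fun a x => x • (Ψ a x + c), fun a => (h1 a).of_shiftStep hB, fun a a' haa => h2 _ _ ?_⟩
  exact eventuallyEq_of_smul_add ((h1 a).map_zero.trans (h1 a').map_zero.symm) c haa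

theorem HasSolutionFamily.of_bbIterate {B : Phase → ℂ × ℂ} {q : ℂ} (hB : IsBriotBouquet B q)
    (k : ℕ) (hq : ∀ j < k, q - j ≠ 1) (h : HasSolutionFamily (bbIterate q q B k)) :
    HasSolutionFamily B := by
  induction k with
  | zero => exact h
  | succ k ih =>
    refine ih (fun j hj => hq j (by omega)) ?_
    rw [bbIterate, bbStep_eq_shiftStep] at h
    exact h.of_shiftStep (hB.bbIterate k fun j hj => hq j (by omega)).map_zero

/-- At `q = 1` with no `x` term every shift `c` leads to a system with eigenvalue `0`, which is
solvable. The resulting solution of the original system has slope `c`, which separates the germs. -/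
theorem IsBriotBouquet.hasSolutionFamily {B : Phase → ℂ × ℂ} (hB : IsBriotBouquet B 1)
    (h : xCoeff B = 0) : HasSolutionFamily B := by
  have hsol : ∀ c : ℂ × ℂ, ∃ φ, IsBriotBouquetSolution (_root_.shiftStep c B) φ := by
    intro c
    have h1 : IsBriotBouquet (_root_.shiftStep c B) ((0 : ℝ) : ℂ) := by
      simpa using hB.shiftStep (c := c) (by simp [h])
    exact h1.exists_solution 1 (fun k => by positivity) (by simp)
  choose φ hφ using hsol
  refine ⟨fun c x => x • (φ (c, 0) x + (c, 0)), fun c => (hφ _).of_shiftStep hB.map_zero, ?_⟩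
  intro c c' hcc
  have hd : ∀ c : ℂ, HasDerivAt (fun x => x • (φ (c, 0) x + (c, 0))) (c, 0) 0 := by
    intro c
    refine ((hasDerivAt_id (0 : ℂ)).smul ((hφ (c, 0)).analytic.differentiableAt.hasDerivAt.add_const
      ((c, 0) : ℂ × ℂ))).congr_deriv ?_
    simp [(hφ (c, 0)).map_zero]
  exact congrArg Prod.fst ((hd c).unique ((hd c').congr_of_eventuallyEq hcc))

/-! ### Center manifolds over the `x`-axis as Briot-Bouquet solutions. -/

section CenterManifold

variable {F G H : Phase → ℂ}

/-- The hypotheses on the linear part of the vector field, in coordinates. -/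
structure HasDiagonalLinearPart (F G H : Phase → ℂ) (a b : ℂ) : Prop where
  analytic_F : AnalyticAt ℂ F 0
  analytic_G : AnalyticAt ℂ G 0
  analytic_H : AnalyticAt ℂ H 0
  F_zero : F 0 = 0
  G_zero : G 0 = 0
  H_zero : H 0 = 0
  ne_zero : a ≠ 0
  fderiv_F : ∀ v, fderiv ℂ F 0 v = a * v.1
  fderiv_G : ∀ v, fderiv ℂ G 0 v = b * v.2.1
  fderiv_H : ∀ v, fderiv ℂ H 0 v = b * v.2.2

namespace HasDiagonalLinearPart

variable {a b : ℂ}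

theorem blowUp_F_ne (hX : HasDiagonalLinearPart F G H a b) :
    ∀ᶠ p in 𝓝 (0 : Phase), blowUp F p ≠ 0 := by
  have h1 := (analyticAt_quotientBlowUp hX.analytic_F hX.F_zero 0).continuousAt
  refine h1.eventually_ne ?_
  rw [quotientBlowUp_zero hX.analytic_F.differentiableAt, hX.fderiv_F]
  simpa using hX.ne_zero

theorem isBriotBouquet (hX : HasDiagonalLinearPart F G H a b) :
    IsBriotBouquet (initialSystem F G H) (b / a - 1) := by
  refine IsBriotBouquet.of_apply_zero ?_ fun u => ?_
  · have hF : AnalyticAt ℂ (blowUp F) 0 := analyticAt_quotientBlowUp hX.analytic_F hX.F_zero 0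
    have hG : AnalyticAt ℂ (blowUp G) 0 := analyticAt_quotientBlowUp hX.analytic_G hX.G_zero 0
    have hH : AnalyticAt ℂ (blowUp H) 0 := analyticAt_quotientBlowUp hX.analytic_H hX.H_zero 0
    have h0 := hX.blowUp_F_ne.self_of_nhds
    have h2 : AnalyticAt ℂ (fun p : Phase => p.2) 0 := analyticAt_snd
    have h21 : AnalyticAt ℂ (fun p : Phase => p.2.1) 0 :=
      ((ContinuousLinearMap.fst ℂ ℂ ℂ).analyticAt _).comp h2
    have h22 : AnalyticAt ℂ (fun p : Phase => p.2.2) 0 :=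
      ((ContinuousLinearMap.snd ℂ ℂ ℂ).analyticAt _).comp h2
    exact ((hG.div hF h0).sub h21).prod ((hH.div hF h0).sub h22)
  · have h1 : blowUp F (0, u) = a := by
      refine (quotientBlowUp_zero hX.analytic_F.differentiableAt u).trans ?_
      simp [hX.fderiv_F]
    have h2 : blowUp G (0, u) = b * u.1 := by
      refine (quotientBlowUp_zero hX.analytic_G.differentiableAt u).trans ?_
      simp [hX.fderiv_G]
    have h3 : blowUp H (0, u) = b * u.2 := by
      refine (quotientBlowUp_zero hX.analytic_H.differentiableAt u).trans ?_
      simp [hX.fderiv_H]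
    simp only [initialSystem, h1, h2, h3]
    ext <;> simp <;> ring

theorem initialSystem_of_ne (hX : HasDiagonalLinearPart F G H a b) {x : ℂ} (hx : x ≠ 0)
    (u : ℂ × ℂ) : initialSystem F G H (x, u)
      = (F (x, x • u))⁻¹ • (G (x, x • u), H (x, x • u)) - u := by
  have h : ∀ f : Phase → ℂ, f 0 = 0 → blowUp f (x, u) = x⁻¹ * f (x, x • u) := fun f hf =>
    quotientBlowUp_of_ne f hf (p := (x, u)) hx
  simp only [initialSystem, h F hX.F_zero, h G hX.G_zero, h H hX.H_zero]
  ext <;> simp [mul_div_mul_left _ _ (inv_ne_zero hx)] <;> ring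

/-- For `x ≠ 0` the tangent vector over `F(x, x φ(x))` is the vector field, because the system says
`h' = (G, H) / F` along the graph. The summand `0` gives the graph the form required by
`eventuallyEq_of_smul_add`. -/
theorem isCenterManifold_of_solution (hX : HasDiagonalLinearPart F G H a b) {φ : ℂ → ℂ × ℂ}
    (hφ : IsBriotBouquetSolution (initialSystem F G H) φ) :
    IsCenterManifold (vectorField F G H) xSplitting fun x => x • (φ x + 0) := by
  have hder : ∀ x, DifferentiableAt ℂ φ x →
      HasDerivAt (fun x => x • (φ x + 0)) (x • deriv φ x + φ x) x := by
    intro x hx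
    refine ((hasDerivAt_id x).smul (hx.hasDerivAt.add_const 0)).congr_deriv ?_
    simp
  refine ⟨analyticAt_id.smul (hφ.analytic.add analyticAt_const), zero_smul _ _, ?_, ?_⟩
  · have := (hder 0 hφ.analytic.differentiableAt).hasFDerivAt.fderiv
    rw [this, hφ.map_zero]
    simp
  · have hcont : Tendsto (fun x => ((x, φ x) : Phase)) (𝓝 0) (𝓝 0) := by
      have := (continuousAt_id (x := (0 : ℂ))).prodMk hφ.analytic.continuousAt
      rwa [ContinuousAt, hφ.map_zero] at this
    filter_upwards [hφ.solution, hφ.analytic.eventually_analyticAt,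
      hcont.eventually hX.blowUp_F_ne] with x h1 h2 h3
    have hd := hder x h2.differentiableAt
    have hg := hasFDerivAt_graphMap xSplitting hd.differentiableAt
    set g := graphMap xSplitting fun x => x • (φ x + 0) with hgdef
    by_cases hx : x = 0
    · have : vectorField F G H (g x) = 0 := by
        have : g x = 0 := by rw [hx]; simp [hgdef, graphMap]
        rw [this]
        simp [vectorField, hX.F_zero, hX.G_zero, hX.H_zero]
      rw [this]
      exact ⟨0, map_zero _⟩
    have hgx : g x = (x, x • φ x) := by simp [hgdef, graphMap, xSplitting]
    have hF : F (x, x • φ x) ≠ 0 := by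
      intro h
      refine h3 ((quotientBlowUp_of_ne F hX.F_zero (p := (x, φ x)) hx).trans ?_)
      simp [h]
    rw [hX.initialSystem_of_ne hx, eq_sub_iff_add_eq] at h1
    refine ⟨F (x, x • φ x), ?_⟩
    rw [hg.fderiv, hgx, hd.hasFDerivAt.fderiv, h1]
    simp [xSplitting, vectorField, hF]

/-- The quotient `h(x) / x` extends analytically and vanishes at `0` by tangency. The `x`-component
of the invariance relation identifies the tangent vector with `F`, which is non-zero for small `x ≠
0` and can be divided out. -/
theorem exists_solution_of_isCenterManifold (hX : HasDiagonalLinearPart F G H a b)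
    {h : ℂ → ℂ × ℂ} (hh : IsCenterManifold (vectorField F G H) xSplitting h) :
    ∃ φ, IsBriotBouquetSolution (initialSystem F G H) φ := by
  have hda : AnalyticAt ℂ (dslope h 0) 0 := by
    obtain ⟨p, hp⟩ := hh.analytic
    exact hp.has_fpower_series_dslope_fslope.analyticAt
  have hhx : ∀ x, h x = x • dslope h 0 x := fun x => by
    have := sub_smul_dslope h 0 x
    rw [hh.map_zero, sub_zero, sub_zero] at this
    exact this.symm
  have hd0 : dslope h 0 0 = 0 := by
    rw [dslope_same, ← fderiv_apply_one_eq_deriv, hh.tangent]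
    rfl
  refine ⟨dslope h 0, hda, hd0, ?_⟩
  have hcont : Tendsto (fun x => ((x, dslope h 0 x) : Phase)) (𝓝 0) (𝓝 0) := by
    have := (continuousAt_id (x := (0 : ℂ))).prodMk hda.continuousAt
    rwa [ContinuousAt, hd0] at this
  filter_upwards [hh.invariant, hda.eventually_analyticAt, hcont.eventually hX.blowUp_F_ne]
    with x h1 h2 h3
  by_cases hx : x = 0
  · subst hx
    rw [zero_smul, hd0]
    exact hX.isBriotBouquet.map_zero.symm
  have hd : HasDerivAt h (x • deriv (dslope h 0) x + dslope h 0 x) x := by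
    have := (hasDerivAt_id x).smul h2.differentiableAt.hasDerivAt
    simpa using this.congr_of_eventuallyEq (Eventually.of_forall hhx)
  have hF : F (x, x • dslope h 0 x) ≠ 0 := by
    intro h
    refine h3 ((quotientBlowUp_of_ne F hX.F_zero (p := (x, dslope _ 0 x)) hx).trans ?_)
    simp [h]
  obtain ⟨v, hv⟩ := h1
  rw [(hasFDerivAt_graphMap xSplitting hd.differentiableAt).fderiv, hd.hasFDerivAt.fderiv] at hv
  have hgx : graphMap xSplitting h x = (x, x • dslope h 0 x) := by
    rw [← hhx]
    rfl
  rw [hgx] at hv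
  have hv1 : v = F (x, x • dslope h 0 x) := congrArg Prod.fst hv
  have hv2 : v • (x • deriv (dslope h 0) x + dslope h 0 x)
      = (G (x, x • dslope h 0 x), H (x, x • dslope h 0 x)) := congrArg Prod.snd hv
  rw [hX.initialSystem_of_ne hx, eq_sub_iff_add_eq, ← hv2, hv1, inv_smul_smul₀ hF]

end HasDiagonalLinearPart

end CenterManifold

/-! ### The diagonal linear part and the three cases of the theorem. -/

theorem linearPart_apply {F G H : Phase → ℂ} (hF : AnalyticAt ℂ F 0)
    (hG : AnalyticAt ℂ G 0) (hH : AnalyticAt ℂ H 0) (v : Phase) :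
    linearPart F G H v = (fderiv ℂ F 0 v, fderiv ℂ G 0 v, fderiv ℂ H 0 v) := by
  have h : HasFDerivAt (vectorField F G H) _ 0 := hF.differentiableAt.hasFDerivAt.prodMk
    (hG.differentiableAt.hasFDerivAt.prodMk hH.differentiableAt.hasFDerivAt)
  change fderiv ℂ (vectorField F G H) 0 v = _
  rw [h.fderiv]
  rfl

/-- A linear map with the `x`-axis and the `(y, z)`-plane as eigenspaces is diagonal. -/
theorem apply_eq_of_eigenspace {A : Phase →ₗ[ℂ] Phase} {a b : ℂ}
    (ha : Module.End.eigenspace A a = xAxis) (hb : Module.End.eigenspace A b = yzPlane)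
    (v : Phase) : A v = (a * v.1, b * v.2.1, b * v.2.2) := by
  have h1 : A (v.1, 0) = a • (v.1, 0) := by
    rw [← Module.End.mem_eigenspace_iff, ha]
    exact ⟨v.1, rfl⟩
  have h2 : A (0, v.2) = b • (0, v.2) := by
    rw [← Module.End.mem_eigenspace_iff, hb]
    exact ⟨v.2, rfl⟩
  have h3 : v = ((v.1, 0) : Phase) + (0, v.2) := by simp
  calc A v = A (((v.1, 0) : Phase) + (0, v.2)) := by rw [← h3]
    _ = _ := by
      rw [map_add, h1, h2]
      ext <;> simp

/-- In the resonant case the reduced system has eigenvalue one. -/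
theorem HasDiagonalLinearPart.isBriotBouquet_bbIterate {F G H : Phase → ℂ} {a b : ℂ}
    (hX : HasDiagonalLinearPart F G H a b) {m : ℕ} (hm : 2 ≤ m) (hab : b / a = m) :
    IsBriotBouquet (initialSystem F G H) ((m : ℂ) - 1) ∧
      (∀ j < m - 2, (m : ℂ) - 1 - j ≠ 1) ∧
      IsBriotBouquet (bbIterate ((m : ℂ) - 1) ((m : ℂ) - 1) (initialSystem F G H) (m - 2)) 1 := by
  have h1 : IsBriotBouquet (initialSystem F G H) ((m : ℂ) - 1) := by
    rw [← hab]
    exact hX.isBriotBouquet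
  have h2 : ∀ j < m - 2, (m : ℂ) - 1 - j ≠ 1 := by
    intro j hj h
    have h3 : (m : ℂ) = ((j + 2 : ℕ) : ℂ) := by
      push_cast
      linear_combination h
    have h4 := Nat.cast_injective h3
    omega
  refine ⟨h1, h2, ?_⟩
  have h3 := h1.bbIterate (m - 2) h2
  have h4 : (m : ℂ) - 1 - (m - 2 : ℕ) = 1 := by
    rw [Nat.cast_sub hm]
    push_cast
    ring
  rwa [h4] at h3

end

theorem theoremT (F G H : Phase → ℂ)
    (hF : AnalyticAt ℂ F 0) (hG : AnalyticAt ℂ G 0) (hH : AnalyticAt ℂ H 0)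
    (hF0 : F 0 = 0) (hG0 : G 0 = 0) (hH0 : H 0 = 0)
    (ω₁ ω₂ : ℝ) (hω₁ : ω₁ ≠ 0) (hne : ω₁ ≠ ω₂) (hle : |ω₁| ≤ |ω₂|)
    (hx : Module.End.eigenspace (linearPart F G H) (Complex.I * ω₁) = xAxis)
    (hyz : Module.End.eigenspace (linearPart F G H) (Complex.I * ω₂) = yzPlane) :
    -- a manifold tangent to the `(y, z)`-plane
    (∃ h : ℂ × ℂ → ℂ, IsCenterManifold (vectorField F G H) yzSplitting h ∧
      HasIsochronousFamily (vectorField F G H) yzSplitting h (2 * Real.pi / |ω₂|)) ∧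
    -- a manifold tangent to the `x`-axis, without resonance
    ((¬ ∃ m : ℕ, ω₂ / ω₁ = m) →
      ∃ h : ℂ → ℂ × ℂ, IsCenterManifold (vectorField F G H) xSplitting h ∧
        HasIsochronousFamily (vectorField F G H) xSplitting h (2 * Real.pi / |ω₁|)) ∧
    -- manifolds tangent to the `x`-axis, with resonance
    (∀ m : ℕ, ω₂ / ω₁ = m →
      ((obstruction F G H m).1 = 0 ∧ (obstruction F G H m).2 = 0 →
        (centerManifoldGerms (vectorField F G H) xSplitting).Infinite ∧
        ∀ h : ℂ → ℂ × ℂ, IsCenterManifold (vectorField F G H) xSplitting h →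
          HasIsochronousFamily (vectorField F G H) xSplitting h (2 * Real.pi / |ω₁|)) ∧
      ((obstruction F G H m).1 ≠ 0 ∨ (obstruction F G H m).2 ≠ 0 →
        ¬ ∃ h : ℂ → ℂ × ℂ, IsCenterManifold (vectorField F G H) xSplitting h)) := by
  set X := vectorField F G H with hXdef
  have hXa : AnalyticAt ℂ X 0 := hF.prod (hG.prod hH)
  have hX0 : X 0 = 0 := by simp [hXdef, vectorField, hF0, hG0, hH0]
  have hω₂ : ω₂ ≠ 0 := by
    rintro rfl
    simp [hω₁] at hle
  have hI₁ : Complex.I * (ω₁ : ℂ) ≠ 0 := by simp [hω₁]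
  have hI₂ : Complex.I * (ω₂ : ℂ) ≠ 0 := by simp [hω₂]
  have hA : ∀ v, fderiv ℂ X 0 v
      = (Complex.I * ω₁ * v.1, Complex.I * ω₂ * v.2.1, Complex.I * ω₂ * v.2.2) :=
    apply_eq_of_eigenspace hx hyz
  have hdiag : HasDiagonalLinearPart F G H (Complex.I * ω₁) (Complex.I * ω₂) := by
    have h : ∀ v, (fderiv ℂ F 0 v, fderiv ℂ G 0 v, fderiv ℂ H 0 v) = _ := fun v =>
      (linearPart_apply hF hG hH v).symm.trans (hA v)
    exact ⟨hF, hG, hH, hF0, hG0, hH0, hI₁, fun v => congrArg Prod.fst (h v),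
      fun v => congrArg (fun w => w.2.1) (h v), fun v => congrArg (fun w => w.2.2) (h v)⟩
  have hxiso : ∀ h : ℂ → ℂ × ℂ, IsCenterManifold X xSplitting h →
      HasIsochronousFamily X xSplitting h (2 * Real.pi / |ω₁|) := by
    refine fun h hh => hh.hasIsochronousFamily xSplitting hXa hX0 hω₁ fun e => ?_
    rw [hA]
    simp [xSplitting]
  have hratio : Complex.I * (ω₂ : ℂ) / (Complex.I * ω₁) = ((ω₂ / ω₁ : ℝ) : ℂ) := by
    rw [mul_div_mul_left _ _ Complex.I_ne_zero]
    push_cast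
    rfl
  refine ⟨?_, ?_, ?_⟩
  -- With base the `(y, z)`-plane the ratio of the eigenvalues is `β = ω₁ / ω₂`, and `|ω₁| ≤ |ω₂|`
  -- gives `β ≤ 1` whatever the signs.
  · have hβ : ω₁ / ω₂ ≤ 1 := by
      refine (le_abs_self _).trans ?_
      rw [abs_div]
      exact div_le_one_of_le₀ hle (abs_nonneg _)
    have hmul : Complex.I * (ω₂ : ℂ) * ((ω₁ / ω₂ : ℝ) : ℂ) = Complex.I * ω₁ := by
      have : (ω₂ : ℂ) ≠ 0 := by exact_mod_cast hω₂
      push_cast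
      field_simp
    obtain ⟨h, hh⟩ := exists_isCenterManifold yzSplitting hXa hX0 hI₂ hβ fun e e' => by
      rw [hA, hmul]
      rfl
    refine ⟨h, hh, hh.hasIsochronousFamily yzSplitting hXa hX0 hω₂ fun e => ?_⟩
    rw [hA]
    ext <;> simp [yzSplitting]
  · intro hm
    have hB : IsBriotBouquet (initialSystem F G H) ((ω₂ / ω₁ - 1 : ℝ) : ℂ) := by
      rw [Complex.ofReal_sub, ← hratio]
      exact hdiag.isBriotBouquet
    -- A resonance `q = k + 1` would mean `ω₂ / ω₁ = k + 2`.
    obtain ⟨n, hn⟩ := exists_nat_ge (ω₂ / ω₁)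
    obtain ⟨φ, hφ⟩ := hB.exists_solution n
      (fun k hk => hm ⟨k + 2, by push_cast; linarith⟩) (by linarith)
    have hh := hdiag.isCenterManifold_of_solution hφ
    exact ⟨_, hh, hxiso _ hh⟩
  · intro m hm
    -- The value `0` is excluded by `ω₂ ≠ 0` and the value `1` by `ω₁ ≠ ω₂`.
    have hm2 : 2 ≤ m := by
      by_contra hlt
      interval_cases m
      · rw [Nat.cast_zero, div_eq_zero_iff] at hm
        exact hm.elim hω₂ hω₁
      · rw [Nat.cast_one, div_eq_one_iff_eq hω₁] at hm
        exact hne hm.symm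
    obtain ⟨hB, hj, hB1⟩ := hdiag.isBriotBouquet_bbIterate hm2 (by rw [hratio, hm]; simp)
    refine ⟨fun hobs => ⟨?_, hxiso⟩, fun hobs => ?_⟩
    · obtain ⟨Ψ, h1, h2⟩ :=
        (hB1.hasSolutionFamily (Prod.ext hobs.1 hobs.2)).of_bbIterate hB (m - 2) hj
      refine Set.infinite_of_injective_forall_mem
        (f := fun c : ℂ => ((fun x => x • (Ψ c x + 0) : ℂ → ℂ × ℂ) : Germ (𝓝 (0 : ℂ)) (ℂ × ℂ)))
        (fun c c' hcc => h2 _ _ ?_) fun c => ⟨_, hdiag.isCenterManifold_of_solution (h1 c), rfl⟩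
      exact eventuallyEq_of_smul_add ((h1 c).map_zero.trans (h1 c').map_zero.symm) 0
        (Germ.coe_eq.1 hcc)
    · rintro ⟨h, hh⟩
      obtain ⟨φ, hφ⟩ := hdiag.exists_solution_of_isCenterManifold hh
      obtain ⟨ψ, hψ⟩ := hφ.exists_bbIterate hB (m - 2) hj
      -- At eigenvalue `1` the slope term in `deriv_zero` has coefficient `1 - 1`, so only the
      -- coefficient of `x` is left.
      have hz : obstruction F G H m = 0 := by
        simpa [obstruction] using hψ.deriv_zero hB1
      rw [hz] at hobs
      simp at hobs
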